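/- **Setting.** Let $\mathcal S,\mathcal A$ be finite non-empty sets of states and actions, $n=|\mathcal S||\mathcal A|$. Let $P(s'|s,a)$ be transition probabilities, $r(s,a,s')$ rewards with $|r|\le 1$, $\gamma\in[0,1)$ a discount factor and $\beta(a|s)$ a behavior policy. Let $(s_k,a_k)_{k\ge 0}$ be the Markov chain on $\mathcal S\times\mathcal A$ with an arbitrary initial distribution and transition probabilities $\mathbb P[s_{k+1}=s',a_{k+1}=a'|s_k=s,a_k=a]=P(s'|s,a)\beta(a'|s')$, and assume that this chain is irreducible and aperiodic. Let $\mu_k$ be the distribution of $(s_k,a_k)$, $\mu_\infty=\lim_k\mu_k$, $d_{\min}=\min\mu_\infty$, $d_{\max}=\max\mu_\infty$, $D_\infty=\mathrm{diag}(\mu_\infty)$. View $P$ as a $(\mathcal S\times\mathcal A)\times\mathcal S$ matrix, let $R(s,a)=\sum_{s'}P(s'|s,a)r(s,a,s')$, and for $Q\in\mathbb R^{\mathcal S\times\mathcal A}$ let $\Pi_Q$ be the $\mathcal S\times(\mathcal S\times\mathcal A)$ matrix of a greedy policy of $Q$ (ties are broken by any fixed rule), so that $(\Pi_QQ)(s)=\max_aQ(s,a)$.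 Let $Q^*$ be the optimal Q-function, the maximum over the deterministic policies of the expected discounted reward, and put $$T=\gamma D_\infty P\Pi_{Q^*}-D_\infty .$$ Let $G$ be the positive definite solution of $GT+T^\top G=-I$, and $B=G^{1/2}TG^{-1/2}$. Write $\|\cdot\|_2$ for the Euclidean norm of vectors and the spectral norm of matrices, so that $\|G\|_2=\lambda_{\max}(G)$. **Step-size.** Let $\alpha_k=\theta/(k+\xi)$. For $c>0$ call $(\theta,\xi)$ $c$-admissible if $0<\theta\le\xi$, if there is $\eta$ with $\eta\theta\ge2$ and $(\eta+\alpha_0\|B\|_2^2)\lambda_{\max}(G)\le1$, and if $$\theta\le c\,\frac{n}{(1-\gamma)d_{\min}},\qquad \xi\le c\,\frac{n^{9/2}d_{\max}^2}{(1-\gamma)^2d_{\min}^2}.$$ **Iterates.** Let $\|Q_0\|_\infty\le1$ and $\|Q^L_0\|_\infty\le1$ be deterministic. Q-learning is $$Q_{k+1}(s_k,a_k)=Q_k(s_k,a_k)+\alpha_k\bigl(r(s_k,a_k,s_{k+1})+\gamma\max_aQ_k(s_{k+1},a)-Q_k(s_k,a_k)\bigr),$$ with the other entries unchanged. Let $w_k$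 be its noise, i.e. $Q_{k+1}=Q_k+\alpha_k(D_\infty R+\gamma D_\infty P\Pi_{Q_k}Q_k-D_\infty Q_k+w_k)$. The lower comparison system is $Q^L_{k+1}-Q^*=(I+\alpha_kT)(Q^L_k-Q^*)+\alpha_kw_k$, and $z_k=G^{1/2}(Q^L_k-Q^*)$, $V(z)=z^\top z$. **Mixing.** Call $m>0$, $\rho\in(0,1)$ mixing constants if, for every starting pair and every $k\ge0$, the distribution of the pair after $k$ steps is within $m\rho^k$ of $\mu_\infty$ in total variation. Let $\tau^{\mathrm{mix}}(\alpha)=\min\{k\in\mathbb N: m\rho^k\le\alpha\}$ and $K_{\mathrm{mix}}=\min\{k: t\ge2\tau^{\mathrm{mix}}(\alpha_t)\ \forall t\ge k\}$. **Proposition.** (i) In this setting mixing constants exist, the solution $G$ exists and is unique, and there is an absolute constant $c_0>0$ such that $\theta=4\lambda_{\max}(G)$, $\xi=\max\{4\lambda_{\max}(G),\,8\lambda_{\max}(G)^2\|B\|_2^2\}$ are always $c_0$-admissible. (ii) For every $c>0$ there is a constant $C>0$, depending only on $c$, such that in this setting, for all mixing constants $m,\rho$, all $c$-admissible $(\theta,\xi)$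 and all $k\ge K_{\mathrm{mix}}$, the random variable $V(z_k)$ is integrable and $$\mathbb E[V(z_k)]\le\frac{C_2}{k+\xi}+\frac{C\,(|\mathcal S||\mathcal A|)^{21/4}}{(1-\gamma)^6d_{\min}^4}\,\frac{\tau^{\mathrm{mix}}(\alpha_k)}{k+\xi},$$ where $$C_2=C\max\left\{\frac{(|\mathcal S||\mathcal A|)^{11/2}d_{\max}^2}{(1-\gamma)^3d_{\min}^3}\,\|Q^L_0-Q^*\|_2^2,\ \frac{(|\mathcal S||\mathcal A|)^5}{(1-\gamma)^6d_{\min}^4}\right\}.$$ -/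

import Mathlib

universe u v w

open Filter Topology MeasureTheory
open scoped Matrix MatrixOrder

noncomputable section

/-- The data of asynchronous Q-learning with Markovian observations, on a finite state space `S` and
a finite action space `A`: the decision process, the behavior policy, the distribution of the
initial state-action pair, the tie-breaking rule of the greedy policies, and the initial iterates
of Q-learning and of the lower comparison system. -/
structure QModel (S A : Type*) [Fintype S] [Fintype A] where
  /-- `trans s a s'` is the probability of moving from `s` to `s'` under the action `a`. -/
  trans : S → A → S → ℝ
  trans_nonneg : ∀ s a s', 0 ≤ trans s a s'
  trans_sum : ∀ s a, ∑ s', trans s a s' = 1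
  /-- `reward s a s'` is the reward received on the transition from `s` to `s'` under `a`. -/
  reward : S → A → S → ℝ
  reward_bound : ∀ s a s', |reward s a s'| ≤ 1
  /-- the discount factor -/
  γ : ℝ
  γ_nonneg : 0 ≤ γ
  γ_lt_one : γ < 1
  /-- `behavior s a` is the probability that the behavior policy plays `a` in the state `s`. -/
  behavior : S → A → ℝ
  behavior_nonneg : ∀ s a, 0 ≤ behavior s a
  behavior_sum : ∀ s, ∑ a, behavior s a = 1
  /-- the distribution of the initial state-action pair -/
  init : S × A → ℝ
  init_nonneg : ∀ x, 0 ≤ init x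
  init_sum : ∑ x, init x = 1
  /-- `greedy Q` is the greedy policy of `Q`. -/
  greedy : (S × A → ℝ) → S → A
  greedy_spec : ∀ (Q : S × A → ℝ) (s : S) (a : A), Q (s, a) ≤ Q (s, greedy Q s)
  /-- the initial iterate of Q-learning -/
  Q₀ : S × A → ℝ
  Q₀_bound : ∀ x, |Q₀ x| ≤ 1
  /-- the initial iterate of the lower comparison system -/
  QL₀ : S × A → ℝ
  QL₀_bound : ∀ x, |QL₀ x| ≤ 1

namespace QModel

variable {S A : Type*} [Fintype S] [Fintype A] [DecidableEq S] [DecidableEq A] (M : QModel S A)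

/-! ### The decision process -/

/-- The vector `R` of expected rewards. -/
def R (x : S × A) : ℝ := ∑ s', M.trans x.1 x.2 s' * M.reward x.1 x.2 s'

/-- The matrix `P` of the transition probabilities from state-action pairs to states. -/
def P : Matrix (S × A) S ℝ := Matrix.of fun x s' => M.trans x.1 x.2 s'

end QModel

/-- The matrix `Π^π` of a deterministic policy `π`, so that `(Π^π Q)(s) = Q(s, π(s))`. -/
def policyMatrix {S A : Type*} [DecidableEq S] [DecidableEq A] (π : S → A) : Matrix S (S × A) ℝ :=
  Matrix.of fun s x => if x = (s, π s) then 1 else 0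

namespace QModel

variable {S A : Type*} [Fintype S] [Fintype A] [DecidableEq S] [DecidableEq A] (M : QModel S A)

/-- The matrix `Π_Q` of the greedy policy of `Q`. -/
def greedyMatrix (Q : S × A → ℝ) : Matrix S (S × A) ℝ := policyMatrix (M.greedy Q)

/-- The Q-function of the deterministic policy `π`: the expected discounted reward when the given
action is played in the given state and `π` is followed afterwards. -/
def policyQ (π : S → A) (x : S × A) : ℝ :=
  ∑' t : ℕ, M.γ ^ t * (((M.P * policyMatrix π) ^ t) *ᵥ M.R) x

/-- The optimal Q-function `Q*`. -/
def Qstar (x : S × A) : ℝ := ⨆ π : S → A, M.policyQ π x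

/-! ### The chain of state-action pairs -/

/-- The transition matrix of the chain of state-action pairs under the behavior policy. -/
def chain : Matrix (S × A) (S × A) ℝ :=
  Matrix.of fun x y => M.trans x.1 x.2 y.1 * M.behavior y.1 y.2

/-- The chain of state-action pairs is irreducible and aperiodic (the greatest common divisor of the
return times of each pair is 1). -/
structure IsErgodic : Prop where
  irreducible : M.chain.IsIrreducible
  aperiodic : ∀ (x : S × A) (g : ℕ), (∀ t : ℕ, 1 ≤ t → 0 < (M.chain ^ t) x x → g ∣ t) → g = 1

/-- The distribution `μ_k` of the state-action pair at time `k`. -/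
def law (k : ℕ) : S × A → ℝ := M.init ᵥ* (M.chain ^ k)

/-- The distribution `μ_∞`, the limit of `μ_k` as `k → ∞`. -/
def lawInf (x : S × A) : ℝ := limUnder atTop fun k => M.law k x

def dmin : ℝ := ⨅ x, M.lawInf x

def dmax : ℝ := ⨆ x, M.lawInf x

/-- The diagonal matrix `D_∞`. -/
def D : Matrix (S × A) (S × A) ℝ := Matrix.diagonal M.lawInf

end QModel

/-- The total variation distance of two distributions on a finite set. -/
def tvDist {X : Type*} [Fintype X] (p q : X → ℝ) : ℝ :=
  ⨆ E : Finset X, |∑ x ∈ E, p x - ∑ x ∈ E, q x|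

namespace QModel

variable {S A : Type*} [Fintype S] [Fintype A] [DecidableEq S] [DecidableEq A] (M : QModel S A)

/-- `m` and `ρ` are constants of geometric mixing: for every starting pair, the distribution after
`k` steps is within `m ρ ^ k` of `μ_∞` in total variation. -/
structure IsMixing (m ρ : ℝ) : Prop where
  m_pos : 0 < m
  ρ_pos : 0 < ρ
  ρ_lt_one : ρ < 1
  dist_le : ∀ (x : S × A) (k : ℕ), tvDist ((M.chain ^ k) x) M.lawInf ≤ m * ρ ^ k

/-- `X k = (s_k, a_k)` is the random sequence of state-action pairs of the model: a Markov chain with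
initial distribution `init` and transition matrix `chain`. -/
structure IsTrajectory {Ω : Type*} [MeasurableSpace Ω] (μ : Measure Ω) (X : ℕ → Ω → S × A) :
    Prop where
  measurable : ∀ k x, MeasurableSet {ω | X k ω = x}
  path_law : ∀ (n : ℕ) (x : ℕ → S × A), μ.real {ω | ∀ i ≤ n, X i ω = x i} =
    M.init (x 0) * ∏ i ∈ Finset.range n, M.chain (x i) (x (i + 1))

/-! ### The coordinate transform -/

/-- The matrix `T = γ D_∞ P Π_{Q*} - D_∞`. -/
def T : Matrix (S × A) (S × A) ℝ := M.γ • (M.D * M.P * M.greedyMatrix M.Qstar) - M.D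

/-- `G` is the positive definite solution of the Lyapunov equation `G T + Tᵀ G = -I`. -/
structure IsLyapunov (G : Matrix (S × A) (S × A) ℝ) : Prop where
  posDef : G.PosDef
  equation : G * M.T + M.Tᵀ * G = -1

/-- The matrix `B = G^{1/2} T G^{-1/2}`. -/
def B (G : Matrix (S × A) (S × A) ℝ) : Matrix (S × A) (S × A) ℝ :=
  CFC.sqrt G * M.T * (CFC.sqrt G)⁻¹

end QModel

/-- The spectral norm of a matrix. -/
def specNorm {X : Type*} [Fintype X] [DecidableEq X] (N : Matrix X X ℝ) : ℝ :=
  ‖Matrix.toEuclideanCLM (n := X) (𝕜 := ℝ) N‖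

/-! ### Step-sizes and mixing time -/

/-- The step-size `α_k = θ / (k + ξ)`. -/
def stepSize (θ ξ : ℝ) (k : ℕ) : ℝ := θ / (k + ξ)

/-- The mixing time `τ(c)`, the least `k` with `m ρ ^ k ≤ c`. -/
def mixTime (m ρ c : ℝ) : ℕ := sInf {k : ℕ | m * ρ ^ k ≤ c}

/-- The least `k` such that `t ≥ 2 τ(α_t)` for all `t ≥ k`. -/
def mixStart (m ρ θ ξ : ℝ) : ℕ :=
  sInf {k : ℕ | ∀ t : ℕ, k ≤ t → 2 * mixTime m ρ (stepSize θ ξ t) ≤ t}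

namespace QModel

variable {S A : Type*} [Fintype S] [Fintype A] [DecidableEq S] [DecidableEq A] (M : QModel S A)

/-- The number `|S| |A|`. -/
def size (_ : QModel S A) : ℝ := (Fintype.card S : ℝ) * (Fintype.card A : ℝ)

/-- The parameters `θ, ξ` of the step-size are admissible, up to the factor `c`: the step-sizes are
at most 1, `θ` is large enough for the contraction `η α_k ≥ 2 / (k + ξ)`, where `η` is a rate with
`η + α_k ‖B‖² ≤ 1 / λ_max(G)` for all `k`, and neither `θ` nor `ξ` is larger than needed
(`‖G‖ = λ_max(G)`, as `G` is positive definite). -/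
structure IsAdmissible (G : Matrix (S × A) (S × A) ℝ) (c θ ξ : ℝ) : Prop where
  θ_pos : 0 < θ
  θ_le_ξ : θ ≤ ξ
  contraction : ∃ η : ℝ, 2 ≤ η * θ ∧ (η + stepSize θ ξ 0 * specNorm (M.B G) ^ 2) * specNorm G ≤ 1
  θ_le : θ ≤ c * (M.size / ((1 - M.γ) * M.dmin))
  ξ_le : ξ ≤ c * (M.size ^ (9 / 2 : ℝ) * M.dmax ^ 2 / ((1 - M.γ) ^ 2 * M.dmin ^ 2))

/-! ### The iterates, along a sequence `x` of state-action pairs -/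

/-- Asynchronous Q-learning: the entry at `(s_k, a_k)` is moved by the step `α_k` times the temporal
difference; the other entries are kept. -/
def iterate (θ ξ : ℝ) (x : ℕ → S × A) : ℕ → S × A → ℝ
  | 0 => M.Q₀
  | k + 1 => Function.update (iterate θ ξ x k) (x k)
      (iterate θ ξ x k (x k) + stepSize θ ξ k *
        (M.reward (x k).1 (x k).2 (x (k + 1)).1
          + M.γ * (⨆ a, iterate θ ξ x k ((x (k + 1)).1, a)) - iterate θ ξ x k (x k)))

/-- The noise `w(o, Q)` of the observation `o`, the transition from the pair `x` to the state `s'`: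
the temporal difference at `x`, minus the mean `D_∞ R + γ D_∞ P Π_Q Q - D_∞ Q`. -/
def noise (Q : S × A → ℝ) (x : S × A) (s' : S) : S × A → ℝ :=
  Pi.single x (M.reward x.1 x.2 s' + M.γ * (M.greedyMatrix Q *ᵥ Q) s' - Q x)
    - (M.D *ᵥ M.R + M.γ • ((M.D * M.P * M.greedyMatrix Q) *ᵥ Q) - M.D *ᵥ Q)

/-- The lower comparison system `Q^L_{k+1} - Q* = (I + α_k T)(Q^L_k - Q*) + α_k w_k`. -/
def lower (θ ξ : ℝ) (x : ℕ → S × A) : ℕ → S × A → ℝ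
  | 0 => M.QL₀
  | k + 1 => M.Qstar + (1 + stepSize θ ξ k • M.T) *ᵥ (lower θ ξ x k - M.Qstar)
      + stepSize θ ξ k • M.noise (M.iterate θ ξ x k) (x k) (x (k + 1)).1

/-- The transformed error `z_k = G^{1/2} (Q^L_k - Q*)`. -/
def z (G : Matrix (S × A) (S × A) ℝ) (θ ξ : ℝ) (x : ℕ → S × A) (k : ℕ) : S × A → ℝ :=
  CFC.sqrt G *ᵥ (M.lower θ ξ x k - M.Qstar)

end QModel

/-- `V(z) = zᵀ z`. -/
def lyapV {X : Type*} [Fintype X] (v : X → ℝ) : ℝ := v ⬝ᵥ v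

namespace QModel

variable {S A : Type*} [Fintype S] [Fintype A] [DecidableEq S] [DecidableEq A] (M : QModel S A)

/-- The constant `C_2` of the bound, for the generic constant `C`. -/
def C₂ (C : ℝ) : ℝ :=
  C * max (M.size ^ (11 / 2 : ℝ) * M.dmax ^ 2 / ((1 - M.γ) ^ 3 * M.dmin ^ 3)
        * ‖WithLp.toLp 2 (M.QL₀ - M.Qstar)‖ ^ 2)
      (M.size ^ 5 / ((1 - M.γ) ^ 6 * M.dmin ^ 4))

end QModel

end

/-! With `e_k = Q^L_k - Q*` one has `V(z_k) = e_kᵀ G e_k`. In one step the Lyapunov equation makes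
the linear drift contribute `-α_k ‖e_k‖²`, and admissibility turns this, together with the
second-order term of the linear part, into the factor `1 - 2/(k+ξ)` (`IsAdmissible.contraction_le`).
What remains is `O(α_k²)` and the cross term `2 α_k w_kᵀ G e_k`, which is not centred because the
observations are Markovian. Freezing the iterates `τ = τ(α_k)` steps earlier costs `O(τ α_k)` in `wᵀ
G e` (`IsErgodic.cross_sub_le`); the frozen noise has mean zero under `μ_∞`, so mixing leaves an
expectation `O(m ρ^τ) = O(α_k)` (`IsErgodic.integral_frozen_cross_le`).

Weighting by `(k+ξ)²` sums the recursion (`weighted_sum_of_recursion`). Before `K_mix` the cross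
term only has a crude bound, but by minimality `K_mix ≤ 2 τ(α_k)` (`mixStart_le`), so these early
steps are absorbed by the term in `τ/(k+ξ)`.

The constants rest on the dissipativity of `T` in the supremum norm, with rate `δ = (1-γ) d_min`.
The Cayley transform `(I+T)(I-T)⁻¹` is then a contraction of that norm when `δ ≤ 1`, and it converts
the Lyapunov equation into a discrete one that can be iterated (`cayley_identity`). This gives
existence, uniqueness and positivity of `G`, the bound `‖G‖ ≤ 2n/δ`, and, applied to `‖T‖² G - Tᵀ G
T`, the bound `‖B‖ ≤ ‖T‖`, free of the condition number of `G`. The contraction of `I + α_k T` also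
keeps `e_k` bounded along every path, so all error estimates before taking expectations are
pathwise. -/

/-! ### Geometric convergence of finite Markov chains -/

lemma exists_lower_bound_of_pos {X : Type*} [Finite X] [Nonempty X] {f : X → X → ℝ}
    (hf : ∀ x y, 0 < f x y) :
    ∃ ε : ℝ, 0 < ε ∧ ∀ x y, ε ≤ f x y := by
  obtain ⟨p, hp⟩ := Finite.exists_min fun p : X × X => f p.1 p.2
  exact ⟨_, hf p.1 p.2, fun x y => hp (x, y)⟩

section StochasticMatrices

variable {X : Type*} [Fintype X] [DecidableEq X] {P : Matrix X X ℝ}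

lemma Matrix.pow_pos_trans (hP : ∀ x y, 0 ≤ P x y) {a b : ℕ} {x y z : X}
    (h₁ : 0 < (P ^ a) x y) (h₂ : 0 < (P ^ b) y z) : 0 < (P ^ (a + b)) x z := by
  rw [pow_add, Matrix.mul_apply]
  exact Finset.sum_pos' (fun w _ => mul_nonneg (Matrix.pow_apply_nonneg hP a x w)
    (Matrix.pow_apply_nonneg hP b w z)) ⟨y, Finset.mem_univ y, mul_pos h₁ h₂⟩

/-- Irreducible aperiodic nonnegative matrices have positive powers. -/
lemma Matrix.IsIrreducible.exists_pow_pos_of_aperiodic (hP : P.IsIrreducible)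
    (hap : ∀ (x : X) (g : ℕ), (∀ t : ℕ, 1 ≤ t → 0 < (P ^ t) x x → g ∣ t) → g = 1) :
    ∃ N : ℕ, 0 < N ∧ ∀ x y, 0 < (P ^ N) x y := by
  -- The return times of `x` form an additive submonoid of `ℕ` with gcd 1, which contains all large
  -- integers.
  have hret : ∀ x : X, ∃ N : ℕ, ∀ m ≥ N, 0 < (P ^ m) x x := by
    intro x
    let s : AddSubmonoid ℕ :=
      { carrier := {t | 0 < (P ^ t) x x}
        zero_mem' := by simp
        add_mem' := fun ha hb => Matrix.pow_pos_trans hP.nonneg ha hb }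
    have hg : Nat.setGcd (s : Set ℕ) = 1 :=
      hap x _ fun t _ ht => Nat.setGcd_dvd_of_mem (s := (s : Set ℕ)) ht
    obtain ⟨N, hN⟩ := Nat.exists_mem_closure_of_ge (s : Set ℕ)
    refine ⟨N, fun m hm => ?_⟩
    have := hN m hm (by rw [hg]; exact one_dvd m)
    rwa [AddSubmonoid.closure_eq] at this
  choose N hN using hret
  choose k _ hk using (Matrix.isIrreducible_iff_exists_pow_pos hP.nonneg).1 hP
  -- The exponent exceeds every `N x + k x y`: the path takes `k x y` steps from `x` to `y` after
  -- spending all the others on a return to `x`.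
  refine ⟨1 + ∑ x, N x + ∑ x, ∑ y, k x y, by omega, fun x y => ?_⟩
  have h₁ : N x ≤ ∑ x, N x := Finset.single_le_sum (fun _ _ => Nat.zero_le _) (Finset.mem_univ x)
  have h₂ : k x y ≤ ∑ x, ∑ y, k x y :=
    (Finset.single_le_sum (fun _ _ => Nat.zero_le _) (Finset.mem_univ y)).trans
      (Finset.single_le_sum (f := fun x => ∑ y, k x y) (fun _ _ => Nat.zero_le _)
        (Finset.mem_univ x))
  obtain ⟨m, hm⟩ := Nat.exists_eq_add_of_le' h₂
  rw [hm, ← add_assoc]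
  exact Matrix.pow_pos_trans hP.nonneg (hN x _ (by omega)) (hk x y)

lemma Matrix.sum_vecMul_of_mem_rowStochastic (hP : P ∈ Matrix.rowStochastic ℝ X) (v : X → ℝ) :
    ∑ y, (v ᵥ* P) y = ∑ x, v x := by
  simp only [Matrix.vecMul, dotProduct]
  rw [Finset.sum_comm]
  simp [← Finset.mul_sum, Matrix.sum_row_of_mem_rowStochastic hP]

/-- Doeblin's argument: as `v` has total mass zero, subtracting `ε` from every entry of `P` does not
change `v P` but lowers the row sums. -/
lemma Matrix.sum_abs_vecMul_le (hP : P ∈ Matrix.rowStochastic ℝ X) {ε : ℝ}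
    (hε : ∀ x y, ε ≤ P x y) {v : X → ℝ} (hv : ∑ x, v x = 0) :
    ∑ y, |(v ᵥ* P) y| ≤ (1 - Fintype.card X * ε) * ∑ x, |v x| := by
  have h : ∀ y, |(v ᵥ* P) y| ≤ ∑ x, |v x| * (P x y - ε) := by
    intro y
    have : (v ᵥ* P) y = ∑ x, v x * (P x y - ε) := by
      simp only [Matrix.vecMul, dotProduct, mul_sub, Finset.sum_sub_distrib, ← Finset.sum_mul, hv]
      ring
    rw [this]
    refine (Finset.abs_sum_le_sum_abs _ _).trans (Finset.sum_le_sum fun x _ => ?_)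
    rw [abs_mul, abs_of_nonneg (sub_nonneg.2 (hε x y))]
  refine (Finset.sum_le_sum fun y _ => h y).trans (le_of_eq ?_)
  rw [Finset.sum_comm, Finset.mul_sum]
  refine Finset.sum_congr rfl fun x _ => ?_
  rw [← Finset.mul_sum, Finset.sum_sub_distrib, Matrix.sum_row_of_mem_rowStochastic hP]
  simp [mul_comm]

lemma Matrix.exists_geometric_contraction [Nonempty X] (hP : P ∈ Matrix.rowStochastic ℝ X)
    {N : ℕ} (hN : 0 < N) (hpos : ∀ x y, 0 < (P ^ N) x y) :
    ∃ C r : ℝ, 0 < C ∧ 0 < r ∧ r < 1 ∧ ∀ (k : ℕ) (v : X → ℝ), ∑ x, v x = 0 →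
      ∑ y, |(v ᵥ* (P ^ k)) y| ≤ C * r ^ k * ∑ x, |v x| := by
  have hPk : ∀ k, P ^ k ∈ Matrix.rowStochastic ℝ X := fun k => pow_mem hP k
  obtain ⟨ε, hε, hεle⟩ := exists_lower_bound_of_pos hpos
  obtain ⟨x₀⟩ := ‹Nonempty X›
  have hε1 : ε ≤ 1 := (hεle x₀ x₀).trans (Matrix.le_one_of_mem_rowStochastic (hPk N))
  have hcard : (1 : ℝ) ≤ Fintype.card X := by
    exact_mod_cast Fintype.card_pos_iff.2 ⟨x₀⟩
  have hN1 : (1 : ℝ) ≤ N := by exact_mod_cast hN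
  -- By Bernoulli's inequality `r ^ N ≥ 1 - ε/2`, which dominates the contraction factor of `P ^ N`;
  -- halving `ε` keeps `r` positive.
  set r : ℝ := 1 - ε / 2 / N with hr
  have hq : ε / 2 / N ≤ 1 / 2 := by
    rw [div_le_iff₀ (by linarith)]; linarith
  have hq0 : 0 < ε / 2 / N := by positivity
  have hr0 : 0 < r := by linarith
  have hr1 : r < 1 := by linarith
  have hrN : 1 - ε / 2 ≤ r ^ N := by
    have := one_add_mul_le_pow (a := -(ε / 2 / N)) (by linarith) N
    have e : 1 + (N : ℝ) * -(ε / 2 / N) = 1 - ε / 2 := by field_simp; ring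
    rw [e] at this
    simpa [hr, sub_eq_add_neg] using this
  have hstep : ∀ v : X → ℝ, ∑ x, v x = 0 →
      ∑ y, |(v ᵥ* (P ^ N)) y| ≤ r ^ N * ∑ x, |v x| := by
    intro v hv
    refine (Matrix.sum_abs_vecMul_le (hPk N) hεle hv).trans ?_
    refine mul_le_mul_of_nonneg_right (le_trans ?_ hrN) (Finset.sum_nonneg fun _ _ => abs_nonneg _)
    nlinarith
  have hsmall : ∀ (t : ℕ) (v : X → ℝ), ∑ x, v x = 0 →
      ∑ y, |(v ᵥ* (P ^ t)) y| ≤ ∑ x, |v x| := by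
    intro t v hv
    have := Matrix.sum_abs_vecMul_le (hPk t) (ε := 0)
      (fun x y => Matrix.nonneg_of_mem_rowStochastic (hPk t)) hv
    simpa using this
  have hmain : ∀ (q t : ℕ) (v : X → ℝ), ∑ x, v x = 0 →
      ∑ y, |(v ᵥ* (P ^ (t + N * q))) y| ≤ r ^ (N * q) * ∑ x, |v x| := by
    intro q
    induction q with
    | zero => intro t v hv; simpa using hsmall t v hv
    | succ q ih =>
      intro t v hv
      have e : v ᵥ* (P ^ (t + N * (q + 1))) = (v ᵥ* (P ^ N)) ᵥ* (P ^ (t + N * q)) := by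
        rw [Matrix.vecMul_vecMul, ← pow_add]; congr 2; ring
      rw [e]
      have h0 : ∑ y, (v ᵥ* (P ^ N)) y = 0 := by
        rw [Matrix.sum_vecMul_of_mem_rowStochastic (hPk N), hv]
      refine (ih t _ h0).trans ?_
      refine (mul_le_mul_of_nonneg_left (hstep v hv) (by positivity)).trans (le_of_eq ?_)
      ring
  -- The `k % N` leftover steps do not increase the `ℓ¹` norm; the constant pays for their missing
  -- powers of `r`.
  refine ⟨(r ^ N)⁻¹, r, by positivity, hr0, hr1, fun k v hv => ?_⟩
  have h := hmain (k / N) (k % N) v hv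
  rw [Nat.mod_add_div] at h
  refine h.trans (mul_le_mul_of_nonneg_right ?_ (Finset.sum_nonneg fun _ _ => abs_nonneg _))
  rw [le_inv_mul_iff₀ (by positivity), ← pow_add]
  refine pow_le_pow_of_le_one hr0.le hr1.le ?_
  have := Nat.mod_add_div k N
  have := Nat.mod_lt k hN
  omega

/-- Convergence of a finite Markov chain with a positive power. -/
lemma Matrix.exists_limit_law [Nonempty X] (hP : P ∈ Matrix.rowStochastic ℝ X)
    {N : ℕ} (hN : 0 < N) (hpos : ∀ x y, 0 < (P ^ N) x y) :
    ∃ (π : X → ℝ) (C r : ℝ), (∀ x, 0 < π x) ∧ 0 < C ∧ 0 < r ∧ r < 1 ∧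
      ∀ μ : X → ℝ, (∀ x, 0 ≤ μ x) → ∑ x, μ x = 1 → ∀ k : ℕ,
        ∑ y, |(μ ᵥ* (P ^ k)) y - π y| ≤ C * r ^ k := by
  have hPk : ∀ k, P ^ k ∈ Matrix.rowStochastic ℝ X := fun k => pow_mem hP k
  obtain ⟨C, r, hC, hr0, hr1, hcon⟩ := Matrix.exists_geometric_contraction hP hN hpos
  have hdist : ∀ μ : X → ℝ, (∀ x, 0 ≤ μ x) → ∑ x, μ x = 1 → ∀ k, (∀ x, 0 ≤ (μ ᵥ* (P ^ k)) x) ∧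
      ∑ x, (μ ᵥ* (P ^ k)) x = 1 := fun μ h0 h1 k =>
    ⟨fun x => Matrix.nonneg_vecMul_of_mem_rowStochastic (hPk k) h0 x,
      by rw [Matrix.sum_vecMul_of_mem_rowStochastic (hPk k), h1]⟩
  have hdiff : ∀ μ ν : X → ℝ, (∀ x, 0 ≤ μ x) → ∑ x, μ x = 1 → (∀ x, 0 ≤ ν x) → ∑ x, ν x = 1 →
      ∀ k, ∑ y, |(μ ᵥ* (P ^ k)) y - (ν ᵥ* (P ^ k)) y| ≤ 2 * C * r ^ k := by
    intro μ ν h1 h2 h3 h4 k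
    have h := hcon k (μ - ν) (by simp [h2, h4])
    have hl : ∑ x, |(μ - ν) x| ≤ 2 := by
      calc ∑ x, |(μ - ν) x| ≤ ∑ x, (μ x + ν x) := Finset.sum_le_sum fun x _ => by
            rw [Pi.sub_apply, abs_le]; constructor <;> linarith [h1 x, h3 x]
        _ = 2 := by rw [Finset.sum_add_distrib, h2, h4]; norm_num
    rw [Matrix.sub_vecMul] at h
    simp only [Pi.sub_apply] at h
    refine h.trans ?_
    calc _ ≤ C * r ^ k * 2 := mul_le_mul_of_nonneg_left hl (by positivity)
      _ = _ := by ring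
  obtain ⟨x₀⟩ := ‹Nonempty X›
  set ν : X → ℝ := Pi.single x₀ 1 with hν
  have hν0 : ∀ x, 0 ≤ ν x := fun x => by
    rw [hν, Pi.single_apply]; split_ifs <;> norm_num
  have hν1 : ∑ x, ν x = 1 := by simp [hν]
  have hlim : ∀ y, ∃ l, Tendsto (fun k => (ν ᵥ* (P ^ k)) y) atTop (𝓝 l) := by
    intro y
    -- Consecutive laws are the images under `P ^ k` of `ν` and `ν P`, hence geometrically close.
    refine cauchySeq_tendsto_of_complete (cauchySeq_of_le_geometric r (2 * C) hr1 fun k => ?_)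
    have h := hdiff ν (ν ᵥ* P) hν0 hν1 (by simpa using (hdist ν hν0 hν1 1).1)
      (by simpa using (hdist ν hν0 hν1 1).2) k
    rw [Matrix.vecMul_vecMul, ← pow_succ'] at h
    rw [Real.dist_eq]
    exact (Finset.single_le_sum (f := fun y => |(ν ᵥ* (P ^ k)) y - (ν ᵥ* (P ^ (k + 1))) y|)
      (fun _ _ => abs_nonneg _) (Finset.mem_univ y)).trans h
  choose π hπ using hlim
  refine ⟨π, 2 * C, r, fun y => ?_, by positivity, hr0, hr1, fun μ h0 h1 k => ?_⟩
  · obtain ⟨ε, hε, hεle⟩ := haveI : Nonempty X := ⟨x₀⟩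
      exists_lower_bound_of_pos hpos
    refine hε.trans_le (ge_of_tendsto ((tendsto_add_atTop_iff_nat N).2 (hπ y)) ?_)
    refine Eventually.of_forall fun k => ?_
    obtain ⟨ha, hb⟩ := hdist ν hν0 hν1 k
    rw [pow_add, ← Matrix.vecMul_vecMul]
    calc ε = ∑ x, (ν ᵥ* (P ^ k)) x * ε := by rw [← Finset.sum_mul, hb, one_mul]
      _ ≤ _ := Finset.sum_le_sum fun x _ => mul_le_mul_of_nonneg_left (hεle x y) (ha x)
  -- `ν P^(j+k)` is the `k`-step law started from `ν P^j`, so the bound between two initial laws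
  -- applies; then `j → ∞`.
  · have ht : Tendsto (fun j => ∑ y, |(μ ᵥ* (P ^ k)) y - (ν ᵥ* (P ^ (j + k))) y|) atTop
        (𝓝 (∑ y, |(μ ᵥ* (P ^ k)) y - π y|)) := by
      refine tendsto_finsetSum _ fun y _ => (tendsto_const_nhds.sub ?_).abs
      exact (tendsto_add_atTop_iff_nat k).2 (hπ y)
    refine le_of_tendsto ht (Eventually.of_forall fun j => ?_)
    obtain ⟨ha, hb⟩ := hdist ν hν0 hν1 j
    have h := hdiff μ (ν ᵥ* (P ^ j)) h0 h1 ha hb k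
    rwa [Matrix.vecMul_vecMul, ← pow_add] at h

end StochasticMatrices

/-! ### Total variation and the `ℓ¹` distance -/

section TotalVariation

variable {X : Type*} [Fintype X]

lemma tvDist_le_sum_abs (p q : X → ℝ) : tvDist p q ≤ ∑ x, |p x - q x| := by
  refine ciSup_le fun E => ?_
  rw [← Finset.sum_sub_distrib]
  refine (Finset.abs_sum_le_sum_abs _ _).trans ?_
  exact Finset.sum_le_sum_of_subset_of_nonneg (Finset.subset_univ E) fun _ _ _ => abs_nonneg _

/-- The positive and the negative part of `p - q` are each tested by one event. -/
lemma sum_abs_sub_le_two_mul_tvDist (p q : X → ℝ) : ∑ x, |p x - q x| ≤ 2 * tvDist p q := by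
  classical
  have hb : BddAbove (Set.range fun E : Finset X => |∑ x ∈ E, p x - ∑ x ∈ E, q x|) :=
    Set.finite_range _ |>.bddAbove
  have h : ∀ E : Finset X, |∑ x ∈ E, (p x - q x)| ≤ tvDist p q := fun E => by
    rw [Finset.sum_sub_distrib]; exact le_ciSup hb E
  rw [← Finset.sum_filter_add_sum_filter_not Finset.univ fun x => 0 ≤ p x - q x, two_mul]
  refine add_le_add ?_ ?_
  · refine le_trans (le_of_eq ?_) ((le_abs_self _).trans
      (h (Finset.univ.filter fun x => 0 ≤ p x - q x)))
    exact Finset.sum_congr rfl fun x hx => abs_of_nonneg (Finset.mem_filter.1 hx).2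
  · refine le_trans (le_of_eq ?_) ((neg_le_abs _).trans
      (h (Finset.univ.filter fun x => ¬ 0 ≤ p x - q x)))
    rw [← Finset.sum_neg_distrib]
    exact Finset.sum_congr rfl fun x hx => abs_of_neg (not_le.1 (Finset.mem_filter.1 hx).2)

end TotalVariation

/-! ### The stationary law and its extreme values -/

lemma QModel.size_eq_card {S A : Type*} [Fintype S] [Fintype A] {M : QModel S A} : M.size = Fintype.card (S × A) := by
  simp [size]

lemma QModel.one_le_size {S A : Type*} [Fintype S] [Fintype A] [Nonempty S] [Nonempty A]
    {M : QModel S A} : 1 ≤ M.size := by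
  rw [size_eq_card]
  exact_mod_cast Fintype.card_pos

namespace QModel

variable {S A : Type*} [Fintype S] [Fintype A] [DecidableEq S] [DecidableEq A] (M : QModel S A)

lemma chain_mem_rowStochastic : M.chain ∈ Matrix.rowStochastic ℝ (S × A) := by
  rw [Matrix.mem_rowStochastic_iff_sum]
  refine ⟨fun x y => mul_nonneg (M.trans_nonneg _ _ _) (M.behavior_nonneg _ _), fun x => ?_⟩
  simp only [chain, Matrix.of_apply, Fintype.sum_prod_type, ← Finset.mul_sum, M.behavior_sum,
    mul_one, M.trans_sum]

variable {M}

/-- The stationary law of an ergodic model is positive and attracts every initial law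
geometrically. -/
lemma IsErgodic.exists_geometric [Nonempty S] [Nonempty A] (hM : M.IsErgodic) :
    (∀ x, 0 < M.lawInf x) ∧ ∑ x, M.lawInf x = 1 ∧ ∃ C r : ℝ, 0 < C ∧ 0 < r ∧ r < 1 ∧
      ∀ μ : S × A → ℝ, (∀ x, 0 ≤ μ x) → ∑ x, μ x = 1 → ∀ k : ℕ,
        ∑ y, |(μ ᵥ* (M.chain ^ k)) y - M.lawInf y| ≤ C * r ^ k := by
  obtain ⟨N, hN, hpos⟩ := hM.irreducible.exists_pow_pos_of_aperiodic hM.aperiodic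
  obtain ⟨π, C, r, hπ, hC, hr0, hr1, h⟩ :=
    Matrix.exists_limit_law M.chain_mem_rowStochastic hN hpos
  have hg : Tendsto (fun k : ℕ => C * r ^ k) atTop (𝓝 0) := by
    simpa using (tendsto_pow_atTop_nhds_zero_of_lt_one hr0.le hr1).const_mul C
  have hlim : ∀ y, Tendsto (fun k => M.law k y) atTop (𝓝 (π y)) := fun y => by
    rw [tendsto_iff_dist_tendsto_zero]
    refine squeeze_zero (fun _ => dist_nonneg) (fun k => ?_) hg
    rw [Real.dist_eq]
    exact (Finset.single_le_sum (f := fun y => |M.law k y - π y|) (fun _ _ => abs_nonneg _)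
      (Finset.mem_univ y)).trans (h M.init M.init_nonneg M.init_sum k)
  have hlaw : M.lawInf = π := funext fun y => (hlim y).limUnder_eq
  refine ⟨fun x => hlaw ▸ hπ x, ?_, C, r, hC, hr0, hr1, hlaw ▸ h⟩
  rw [hlaw]
  refine tendsto_nhds_unique (tendsto_finsetSum _ fun y _ => hlim y) ?_
  have : ∀ k, ∑ y, M.law k y = 1 := fun k => by
    rw [law, Matrix.sum_vecMul_of_mem_rowStochastic (pow_mem M.chain_mem_rowStochastic k),
      M.init_sum]
  simp [this]

lemma IsErgodic.lawInf_pos [Nonempty S] [Nonempty A] (hM : M.IsErgodic) (x : S × A) :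
    0 < M.lawInf x := hM.exists_geometric.1 x

lemma IsErgodic.sum_lawInf [Nonempty S] [Nonempty A] (hM : M.IsErgodic) :
    ∑ x, M.lawInf x = 1 := hM.exists_geometric.2.1

lemma IsErgodic.exists_isMixing [Nonempty S] [Nonempty A] (hM : M.IsErgodic) :
    ∃ m ρ : ℝ, M.IsMixing m ρ := by
  obtain ⟨-, -, C, r, hC, hr0, hr1, h⟩ := hM.exists_geometric
  refine ⟨C, r, hC, hr0, hr1, fun x k => (tvDist_le_sum_abs _ _).trans ?_⟩
  have := h (Pi.single x 1) (fun y => by rw [Pi.single_apply]; split_ifs <;> norm_num)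
    (by simp) k
  rwa [Matrix.single_one_vecMul] at this

lemma IsErgodic.dmin_pos [Nonempty S] [Nonempty A] (hM : M.IsErgodic) : 0 < M.dmin := by
  obtain ⟨x, hx⟩ := exists_eq_ciInf_of_finite (f := M.lawInf)
  rw [dmin, ← hx]
  exact hM.lawInf_pos x

lemma dmin_le_lawInf (x : S × A) : M.dmin ≤ M.lawInf x :=
  ciInf_le (Set.finite_range _).bddBelow x

lemma lawInf_le_dmax (x : S × A) : M.lawInf x ≤ M.dmax :=
  le_ciSup (Set.finite_range _).bddAbove x

lemma IsErgodic.one_le_size_mul_dmax [Nonempty S] [Nonempty A] (hM : M.IsErgodic) :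
    1 ≤ M.size * M.dmax := by
  rw [← hM.sum_lawInf, size_eq_card]
  simpa using Finset.sum_le_sum fun x (_ : x ∈ Finset.univ) => M.lawInf_le_dmax x

lemma IsErgodic.lawInf_le_one [Nonempty S] [Nonempty A] (hM : M.IsErgodic) (x : S × A) :
    M.lawInf x ≤ 1 := by
  rw [← hM.sum_lawInf]
  exact Finset.single_le_sum (fun y _ => (hM.lawInf_pos y).le) (Finset.mem_univ x)

lemma IsErgodic.dmax_le_one [Nonempty S] [Nonempty A] (hM : M.IsErgodic) : M.dmax ≤ 1 :=
  ciSup_le hM.lawInf_le_one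

end QModel

/-! ### Euclidean and spectral norms -/

section EuclideanNorm

variable {X : Type*} [Fintype X]

/-- The Euclidean norm of a vector. -/
noncomputable def l2norm (v : X → ℝ) : ℝ := ‖WithLp.toLp 2 v‖

lemma l2norm_nonneg (v : X → ℝ) : 0 ≤ l2norm v := norm_nonneg _

lemma l2norm_sq (v : X → ℝ) : l2norm v ^ 2 = v ⬝ᵥ v := by
  rw [l2norm, EuclideanSpace.real_norm_sq_eq]
  simp [dotProduct, sq]

lemma abs_dotProduct_le (v w : X → ℝ) : |v ⬝ᵥ w| ≤ l2norm v * l2norm w := by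
  have h := abs_real_inner_le_norm (WithLp.toLp 2 w) (WithLp.toLp 2 v)
  rw [EuclideanSpace.inner_toLp_toLp] at h
  simpa [l2norm, mul_comm] using h

lemma l2norm_add_le (v w : X → ℝ) : l2norm (v + w) ≤ l2norm v + l2norm w := by
  simpa [l2norm] using norm_add_le (WithLp.toLp 2 v) (WithLp.toLp 2 w)

lemma norm_le_l2norm (v : X → ℝ) : ‖v‖ ≤ l2norm v := by
  refine (pi_norm_le_iff_of_nonneg (l2norm_nonneg v)).2 fun i => ?_
  exact PiLp.norm_apply_le (WithLp.toLp 2 v) i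

lemma l2norm_sq_le (v : X → ℝ) : l2norm v ^ 2 ≤ Fintype.card X * ‖v‖ ^ 2 := by
  rw [l2norm, EuclideanSpace.real_norm_sq_eq]
  refine (Finset.sum_le_sum fun i _ => ?_).trans (b := ∑ _i : X, ‖v‖ ^ 2) (by simp)
  have h := pow_le_pow_left₀ (norm_nonneg _) (norm_le_pi_norm v i) 2
  rwa [Real.norm_eq_abs, sq_abs] at h

lemma l2norm_le (v : X → ℝ) : l2norm v ≤ √(Fintype.card X) * ‖v‖ := by
  refine le_of_sq_le_sq ?_ (by positivity)
  rw [mul_pow, Real.sq_sqrt (by positivity)]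
  exact l2norm_sq_le v

lemma l2norm_le_sum_abs (v : X → ℝ) : l2norm v ≤ ∑ x, |v x| := by
  refine le_of_sq_le_sq ?_ (Finset.sum_nonneg fun _ _ => abs_nonneg _)
  rw [l2norm, EuclideanSpace.real_norm_sq_eq]
  simpa using Finset.sum_sq_le_sq_sum_of_nonneg (s := Finset.univ) (f := fun x => |v x|)
    fun _ _ => abs_nonneg _

variable [DecidableEq X]

lemma specNorm_nonneg (N : Matrix X X ℝ) : 0 ≤ specNorm N := norm_nonneg _

lemma l2norm_mulVec_le (N : Matrix X X ℝ) (v : X → ℝ) :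
    l2norm (N *ᵥ v) ≤ specNorm N * l2norm v := by
  have h := (Matrix.toEuclideanCLM (n := X) (𝕜 := ℝ) N).le_opNorm (WithLp.toLp 2 v)
  rwa [Matrix.toEuclideanCLM_toLp] at h

lemma specNorm_le {N : Matrix X X ℝ} {C : ℝ} (hC : 0 ≤ C)
    (h : ∀ v, l2norm (N *ᵥ v) ≤ C * l2norm v) : specNorm N ≤ C := by
  refine ContinuousLinearMap.opNorm_le_bound _ hC fun x => ?_
  have := h (WithLp.ofLp x)
  rw [l2norm, l2norm, ← Matrix.toEuclideanCLM_toLp] at this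
  simpa using this

lemma abs_dotProduct_mulVec_le (N : Matrix X X ℝ) (v w : X → ℝ) :
    |v ⬝ᵥ N *ᵥ w| ≤ l2norm v * (specNorm N * l2norm w) :=
  (abs_dotProduct_le _ _).trans
    (mul_le_mul_of_nonneg_left (l2norm_mulVec_le N w) (l2norm_nonneg v))

/-- Any finite constant suffices: in the Cayley iterations below it is multiplied by `(1 - δ) ^ j`
and disappears in the limit. -/
lemma exists_abs_dotProduct_mulVec_le (N : Matrix X X ℝ) :
    ∃ C : ℝ, 0 ≤ C ∧ ∀ v w : X → ℝ, |v ⬝ᵥ N *ᵥ w| ≤ C * (‖v‖ * ‖w‖) := by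
  set s := √(Fintype.card X : ℝ)
  refine ⟨s * (specNorm N * s), by have := specNorm_nonneg N; positivity, fun v w => ?_⟩
  refine (abs_dotProduct_mulVec_le N v w).trans ?_
  calc l2norm v * (specNorm N * l2norm w) ≤ (s * ‖v‖) * (specNorm N * (s * ‖w‖)) := by
        gcongr
        · exact mul_nonneg (specNorm_nonneg N) (l2norm_nonneg w)
        · exact l2norm_le v
        · exact specNorm_nonneg N
        · exact l2norm_le w
    _ = _ := by ring

lemma Matrix.eq_zero_of_dotProduct_mulVec {N : Matrix X X ℝ}
    (h : ∀ v w : X → ℝ, v ⬝ᵥ N *ᵥ w = 0) : N = 0 := by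
  ext i j
  simpa using h (Pi.single i 1) (Pi.single j 1)

end EuclideanNorm

/-! ### Lyapunov equations for sup-norm dissipative matrices -/

section Lyapunov

variable {X : Type*} [Fintype X]

/-- `T` is dissipative in the supremum norm, with rate `δ`. -/
structure IsSupDissipative (T : Matrix X X ℝ) (δ : ℝ) : Prop where
  pos : 0 < δ
  le_norm_sub : ∀ u, (1 + δ) * ‖u‖ ≤ ‖u - T *ᵥ u‖
  norm_add_le : ∀ u, ‖u + T *ᵥ u‖ ≤ (1 - δ) * ‖u‖

namespace IsSupDissipative

variable {T : Matrix X X ℝ} {δ : ℝ}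

lemma norm_le_norm_sub (hT : IsSupDissipative T δ) (u : X → ℝ) : ‖u‖ ≤ ‖u - T *ᵥ u‖ := by
  have := hT.le_norm_sub u
  nlinarith [norm_nonneg u, hT.pos]

/-- This bounds the Cayley transform `(I+T)(I-T)⁻¹` in the supremum norm. -/
lemma norm_add_le_norm_sub (hT : IsSupDissipative T δ) (u : X → ℝ) :
    ‖u + T *ᵥ u‖ ≤ |1 - δ| * ‖u - T *ᵥ u‖ :=
  (hT.norm_add_le u).trans ((mul_le_mul_of_nonneg_right (le_abs_self _) (norm_nonneg u)).trans
    (mul_le_mul_of_nonneg_left (hT.norm_le_norm_sub u) (abs_nonneg _)))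

variable [DecidableEq X]

lemma exists_sub_eq (hT : IsSupDissipative T δ) (v : X → ℝ) : ∃ u, u - T *ᵥ u = v := by
  have hinj : Function.Injective (1 - T).mulVecLin := by
    rw [← LinearMap.ker_eq_bot, LinearMap.ker_eq_bot']
    intro u hu
    have h := hT.le_norm_sub u
    rw [Matrix.mulVecLin_apply, Matrix.sub_mulVec, Matrix.one_mulVec] at hu
    rw [hu, norm_zero] at h
    have := hT.pos
    have := norm_nonneg u
    exact norm_eq_zero.1 (by nlinarith)
  obtain ⟨u, hu⟩ := LinearMap.injective_iff_surjective.1 hinj v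
  exact ⟨u, by simpa [Matrix.sub_mulVec] using hu⟩

end IsSupDissipative

/-- This passes from continuous to discrete time: for `K = (I+T)(I-T)⁻¹`, the form of `H` differs
from its pullback by `K` only through `H T + Tᵀ H`. -/
lemma cayley_identity (H T : Matrix X X ℝ) (u w : X → ℝ) :
    (u - T *ᵥ u) ⬝ᵥ H *ᵥ (w - T *ᵥ w) =
      (u + T *ᵥ u) ⬝ᵥ H *ᵥ (w + T *ᵥ w) - 2 * (u ⬝ᵥ (H * T + Tᵀ * H) *ᵥ w) := by
  have h : u ⬝ᵥ (Tᵀ * H) *ᵥ w = (T *ᵥ u) ⬝ᵥ H *ᵥ w := by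
    rw [← Matrix.mulVec_mulVec, Matrix.dotProduct_mulVec, Matrix.vecMul_transpose]
  rw [Matrix.add_mulVec, dotProduct_add, h, ← Matrix.mulVec_mulVec]
  simp only [Matrix.mulVec_sub, Matrix.mulVec_add, sub_dotProduct, dotProduct_sub, add_dotProduct,
    dotProduct_add]
  ring

namespace IsSupDissipative

variable [DecidableEq X] {T : Matrix X X ℝ} {δ : ℝ}

/-- The form of such an `H` is invariant under the Cayley transform, whose powers tend to zero. -/
lemma eq_zero_of_lyapunov (hT : IsSupDissipative T δ) (hδ : δ ≤ 1) {H : Matrix X X ℝ}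
    (hH : H * T + Tᵀ * H = 0) : H = 0 := by
  have habs : |1 - δ| = 1 - δ := abs_of_nonneg (by linarith)
  have hpos := hT.pos
  refine Matrix.eq_zero_of_dotProduct_mulVec ?_
  obtain ⟨C, hC, hb⟩ := exists_abs_dotProduct_mulVec_le H
  have key : ∀ (j : ℕ) (v w : X → ℝ), |v ⬝ᵥ H *ᵥ w| ≤ C * (1 - δ) ^ j * (‖v‖ * ‖w‖) := by
    intro j
    induction j with
    | zero => simpa using hb
    | succ j ih =>
      intro v w
      obtain ⟨u, rfl⟩ := hT.exists_sub_eq v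
      obtain ⟨t, rfl⟩ := hT.exists_sub_eq w
      rw [cayley_identity, hH, Matrix.zero_mulVec, dotProduct_zero, mul_zero, sub_zero]
      refine (ih _ _).trans ?_
      have h1 := hT.norm_add_le_norm_sub u
      have h2 := hT.norm_add_le_norm_sub t
      rw [habs] at h1 h2
      have h3 : ‖t + T *ᵥ t‖ ≤ ‖t - T *ᵥ t‖ := h2.trans (by
        have := norm_nonneg (t - T *ᵥ t); nlinarith)
      have h0 : 0 ≤ C * (1 - δ) ^ j := mul_nonneg hC (pow_nonneg (by linarith) _)
      calc C * (1 - δ) ^ j * (‖u + T *ᵥ u‖ * ‖t + T *ᵥ t‖)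
          ≤ C * (1 - δ) ^ j * (((1 - δ) * ‖u - T *ᵥ u‖) * ‖t - T *ᵥ t‖) := by
            gcongr
        _ = _ := by rw [pow_succ]; ring
  intro v w
  have hlim : Tendsto (fun j : ℕ => C * (1 - δ) ^ j * (‖v‖ * ‖w‖)) atTop (𝓝 0) := by
    simpa using ((tendsto_pow_atTop_nhds_zero_of_lt_one (r := 1 - δ) (by linarith)
      (by linarith)).const_mul C).mul_const (‖v‖ * ‖w‖)
  exact abs_eq_zero.1 (le_antisymm (ge_of_tendsto' hlim fun j => key j v w) (abs_nonneg _))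

/-- Each application of the Cayley transform costs at most `2 c ‖v‖²` and multiplies `‖v‖²` by at
most `1 - δ`; the geometric series sums to `2 c / δ`. Since no sign of `H` is assumed, the same
estimate also yields positivity. -/
lemma quadratic_le_of_lyapunov (hT : IsSupDissipative T δ) (hδ : δ ≤ 1) {H : Matrix X X ℝ} {c : ℝ}
    (hc : 0 ≤ c) (hH : ∀ u, -(u ⬝ᵥ (H * T + Tᵀ * H) *ᵥ u) ≤ c * ‖u‖ ^ 2) (v : X → ℝ) :
    v ⬝ᵥ H *ᵥ v ≤ 2 * c / δ * ‖v‖ ^ 2 := by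
  have habs : |1 - δ| = 1 - δ := abs_of_nonneg (by linarith)
  have hpos := hT.pos
  obtain ⟨C, hC, hb⟩ := exists_abs_dotProduct_mulVec_le H
  have key : ∀ (j : ℕ) (v : X → ℝ),
      v ⬝ᵥ H *ᵥ v ≤ (2 * c / δ + C * (1 - δ) ^ j) * ‖v‖ ^ 2 := by
    intro j
    induction j with
    | zero =>
      intro v
      have := (le_abs_self _).trans (hb v v)
      have h0 : 0 ≤ 2 * c / δ * ‖v‖ ^ 2 := by positivity
      simp only [pow_zero, mul_one]
      nlinarith
    | succ j ih =>
      intro v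
      obtain ⟨u, rfl⟩ := hT.exists_sub_eq v
      rw [cayley_identity]
      have h1 := hT.norm_add_le_norm_sub u
      rw [habs] at h1
      set N := ‖u - T *ᵥ u‖
      have hN : 0 ≤ N := norm_nonneg _
      have h2 : c * ‖u‖ ^ 2 ≤ c * N ^ 2 := by
        have := hT.norm_le_norm_sub u
        gcongr
      have h3 : ‖u + T *ᵥ u‖ ^ 2 ≤ (1 - δ) * N ^ 2 := by
        calc ‖u + T *ᵥ u‖ ^ 2 ≤ ((1 - δ) * N) ^ 2 := by gcongr
          _ = (1 - δ) * ((1 - δ) * N ^ 2) := by ring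
          _ ≤ (1 - δ) * N ^ 2 := by
            refine mul_le_mul_of_nonneg_left ?_ (by linarith)
            nlinarith [sq_nonneg N]
      have h4 := ih (u + T *ᵥ u)
      have h5 : 0 ≤ 2 * c / δ + C * (1 - δ) ^ j :=
        add_nonneg (by positivity) (mul_nonneg hC (pow_nonneg (by linarith) _))
      have h6 := mul_le_mul_of_nonneg_left h3 h5
      have h7 := hH u
      -- `2 c / δ` is the fixed point of `b ↦ (1 - δ) b + 2 c`.
      have e : (2 * c / δ + C * (1 - δ) ^ j) * ((1 - δ) * N ^ 2) =
          (2 * c / δ + C * (1 - δ) ^ (j + 1)) * N ^ 2 - 2 * (c * N ^ 2) := by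
        rw [pow_succ]; field_simp; ring
      linarith
  have hlim : Tendsto (fun j : ℕ => (2 * c / δ + C * (1 - δ) ^ j) * ‖v‖ ^ 2) atTop
      (𝓝 (2 * c / δ * ‖v‖ ^ 2)) := by
    simpa using (((tendsto_pow_atTop_nhds_zero_of_lt_one (r := 1 - δ) (by linarith)
      (by linarith)).const_mul C).const_add (2 * c / δ)).mul_const (‖v‖ ^ 2)
  exact ge_of_tendsto' hlim fun j => key j v

lemma quadratic_nonneg_of_lyapunov (hT : IsSupDissipative T δ) (hδ : δ ≤ 1) {H : Matrix X X ℝ}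
    (hH : ∀ u, u ⬝ᵥ (H * T + Tᵀ * H) *ᵥ u ≤ 0) (v : X → ℝ) : 0 ≤ v ⬝ᵥ H *ᵥ v := by
  have h := hT.quadratic_le_of_lyapunov hδ (H := -H) le_rfl (fun u => by
    have := hH u
    rw [Matrix.neg_mul, Matrix.mul_neg, ← neg_add, Matrix.neg_mulVec, dotProduct_neg]
    linarith) v
  rw [Matrix.neg_mulVec, dotProduct_neg] at h
  simp only [mul_zero, zero_div, zero_mul] at h
  linarith

/-- `Gᵀ` solves the same equation, so `G` is symmetric by uniqueness. A null vector of the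
semidefinite `G` would annihilate the form of `-I`, hence vanishes. -/
lemma posDef_of_lyapunov (hT : IsSupDissipative T δ) (hδ : δ ≤ 1) {G : Matrix X X ℝ}
    (hG : G * T + Tᵀ * G = -1) : G.PosDef := by
  have hsymm : Gᵀ = G := by
    rw [← sub_eq_zero]
    refine hT.eq_zero_of_lyapunov hδ ?_
    have h := congrArg Matrix.transpose hG
    rw [Matrix.transpose_add, Matrix.transpose_mul, Matrix.transpose_mul, Matrix.transpose_transpose,
      Matrix.transpose_neg, Matrix.transpose_one] at h
    rw [Matrix.sub_mul, Matrix.mul_sub]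
    calc Gᵀ * T - G * T + (Tᵀ * Gᵀ - Tᵀ * G) = (Tᵀ * Gᵀ + Gᵀ * T) - (G * T + Tᵀ * G) := by abel
      _ = 0 := by rw [h, hG, sub_self]
  have hnn := hT.quadratic_nonneg_of_lyapunov hδ (H := G) fun u => by
    rw [hG, Matrix.neg_mulVec, Matrix.one_mulVec, dotProduct_neg, ← l2norm_sq]
    nlinarith [sq_nonneg (l2norm u)]
  have hherm : G.IsHermitian := by
    rw [Matrix.IsHermitian, Matrix.conjTranspose_eq_transpose_of_trivial, hsymm]
  have hpsd : G.PosSemidef := Matrix.PosSemidef.of_dotProduct_mulVec_nonneg hherm fun v => by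
    simpa using hnn v
  refine Matrix.PosDef.of_dotProduct_mulVec_pos hherm fun v hv => ?_
  refine lt_of_le_of_ne (by simpa using hnn v) fun h0 => hv ?_
  have hz : G *ᵥ v = 0 := (hpsd.dotProduct_mulVec_zero_iff v).1 h0.symm
  have h := congrArg (fun N => v ⬝ᵥ N *ᵥ v) hG
  simp only [Matrix.add_mulVec, ← Matrix.mulVec_mulVec, hz, Matrix.mulVec_zero, add_zero,
    Matrix.neg_mulVec, Matrix.one_mulVec, dotProduct_neg] at h
  rw [Matrix.dotProduct_mulVec, ← Matrix.mulVec_transpose, hsymm, hz, zero_dotProduct] at h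
  exact dotProduct_self_eq_zero.1 (by linarith)

/-- The operator `H ↦ H T + Tᵀ H` is injective on a finite-dimensional space, hence surjective. -/
lemma exists_lyapunov (hT : IsSupDissipative T δ) (hδ : δ ≤ 1) :
    ∃ G : Matrix X X ℝ, G * T + Tᵀ * G = -1 := by
  let L : Matrix X X ℝ →ₗ[ℝ] Matrix X X ℝ :=
    LinearMap.mulRight ℝ T + LinearMap.mulLeft ℝ Tᵀ
  have hinj : Function.Injective L := by
    rw [← LinearMap.ker_eq_bot, LinearMap.ker_eq_bot']
    exact fun H hH => hT.eq_zero_of_lyapunov hδ (by simpa [L] using hH)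
  obtain ⟨G, hG⟩ := LinearMap.injective_iff_surjective.1 hinj (-1)
  exact ⟨G, by simpa [L] using hG⟩

end IsSupDissipative

variable [DecidableEq X]

lemma sqrt_mul_sqrt {G : Matrix X X ℝ} (hG : G.PosSemidef) : CFC.sqrt G * CFC.sqrt G = G :=
  CFC.sqrt_mul_sqrt_self G (Matrix.nonneg_iff_posSemidef.2 hG)

lemma sqrt_transpose (G : Matrix X X ℝ) : (CFC.sqrt G)ᵀ = CFC.sqrt G := by
  have h := (Matrix.nonneg_iff_posSemidef.1 (CFC.sqrt_nonneg G)).isHermitian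
  rwa [Matrix.IsHermitian, Matrix.conjTranspose_eq_transpose_of_trivial] at h

lemma l2norm_sqrt_mulVec_sq {G : Matrix X X ℝ} (hG : G.PosSemidef) (v : X → ℝ) :
    l2norm (CFC.sqrt G *ᵥ v) ^ 2 = v ⬝ᵥ G *ᵥ v := by
  nth_rw 2 [← sqrt_mul_sqrt hG]
  rw [l2norm_sq, ← Matrix.mulVec_mulVec, Matrix.dotProduct_mulVec v, ← Matrix.mulVec_transpose,
    sqrt_transpose]

lemma specNorm_le_of_quadratic_le {G : Matrix X X ℝ} (hG : G.PosSemidef) {C : ℝ} (hC : 0 ≤ C)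
    (h : ∀ v, v ⬝ᵥ G *ᵥ v ≤ C * l2norm v ^ 2) : specNorm G ≤ C := by
  have h1 : ∀ v, l2norm (CFC.sqrt G *ᵥ v) ≤ √C * l2norm v := fun v => by
    refine le_of_sq_le_sq ?_ (mul_nonneg (Real.sqrt_nonneg _) (l2norm_nonneg v))
    rw [l2norm_sqrt_mulVec_sq hG, mul_pow, Real.sq_sqrt hC]
    exact h v
  refine specNorm_le hC fun v => ?_
  nth_rw 1 [← sqrt_mul_sqrt hG]
  rw [← Matrix.mulVec_mulVec]
  refine (h1 _).trans ((mul_le_mul_of_nonneg_left (h1 v) (Real.sqrt_nonneg _)).trans (le_of_eq ?_))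
  rw [← mul_assoc, Real.mul_self_sqrt hC]

lemma isUnit_sqrt {G : Matrix X X ℝ} (hG : G.PosDef) : IsUnit (CFC.sqrt G).det := by
  have h : IsUnit G.det := (Matrix.isUnit_iff_isUnit_det G).1 hG.isUnit
  rw [← sqrt_mul_sqrt hG.posSemidef, Matrix.det_mul] at h
  exact isUnit_of_mul_isUnit_left h

end Lyapunov

/-! ### Dissipativity of `T`, the size of `G` and `B`, and admissible step-sizes -/

namespace QModel

variable {S A : Type*} [Fintype S] [Fintype A] [DecidableEq S] [DecidableEq A] {M : QModel S A}

lemma greedyMatrix_mulVec (Q u : S × A → ℝ) (s : S) :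
    (M.greedyMatrix Q *ᵥ u) s = u (s, M.greedy Q s) := by
  simp [greedyMatrix, policyMatrix, Matrix.mulVec, dotProduct]

omit [DecidableEq S] [DecidableEq A] in
lemma abs_P_mulVec_le {f : S → ℝ} {b : ℝ} (hf : ∀ s, |f s| ≤ b) (x : S × A) :
    |(M.P *ᵥ f) x| ≤ b := by
  simp only [P, Matrix.mulVec, dotProduct, Matrix.of_apply]
  refine (Finset.abs_sum_le_sum_abs _ _).trans ?_
  calc ∑ s, |M.trans x.1 x.2 s * f s| ≤ ∑ s, M.trans x.1 x.2 s * b :=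
        Finset.sum_le_sum fun s _ => by
          rw [abs_mul, abs_of_nonneg (M.trans_nonneg _ _ _)]
          exact mul_le_mul_of_nonneg_left (hf s) (M.trans_nonneg _ _ _)
    _ = b := by rw [← Finset.sum_mul, M.trans_sum, one_mul]

lemma abs_greedyMatrix_mulVec_le (Q u : S × A → ℝ) (s : S) :
    |(M.greedyMatrix Q *ᵥ u) s| ≤ ‖u‖ := by
  rw [greedyMatrix_mulVec]
  exact norm_le_pi_norm u _

lemma D_mul_P_mul_mulVec (Q u : S × A → ℝ) (x : S × A) :
    ((M.D * M.P * M.greedyMatrix Q) *ᵥ u) x =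
      M.lawInf x * (M.P *ᵥ (M.greedyMatrix Q *ᵥ u)) x := by
  rw [Matrix.mul_assoc, ← Matrix.mulVec_mulVec, ← Matrix.mulVec_mulVec, D,
    Matrix.mulVec_diagonal]

lemma T_mulVec (u : S × A → ℝ) (x : S × A) : (M.T *ᵥ u) x =
    M.lawInf x * (M.γ * (M.P *ᵥ (M.greedyMatrix M.Qstar *ᵥ u)) x - u x) := by
  rw [T, Matrix.sub_mulVec, Matrix.smul_mulVec, Pi.sub_apply, Pi.smul_apply, D_mul_P_mul_mulVec,
    D, Matrix.mulVec_diagonal, smul_eq_mul]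
  ring

lemma abs_P_greedy_mulVec_le (u : S × A → ℝ) (x : S × A) :
    |(M.P *ᵥ (M.greedyMatrix M.Qstar *ᵥ u)) x| ≤ ‖u‖ :=
  abs_P_mulVec_le (abs_greedyMatrix_mulVec_le _ u) x

lemma abs_gamma_mul_P_greedy_le (u : S × A → ℝ) (x : S × A) :
    |M.γ * (M.P *ᵥ (M.greedyMatrix M.Qstar *ᵥ u)) x| ≤ M.γ * ‖u‖ := by
  rw [abs_mul, abs_of_nonneg M.γ_nonneg]
  exact mul_le_mul_of_nonneg_left (abs_P_greedy_mulVec_le u x) M.γ_nonneg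

variable [Nonempty S] [Nonempty A]

/-- Entry `x` of the image combines `u x` with weight `1 - a d` and a `γ`-discounted average of `u`
with weight `a d`, where `d = μ_∞(x)`; the loss is `a d (1-γ)`, least at `d_min`. -/
lemma IsErgodic.norm_add_smul_T_le (hM : M.IsErgodic) {a : ℝ} (ha : 0 ≤ a) (ha1 : a ≤ 1)
    (u : S × A → ℝ) :
    ‖u + a • M.T *ᵥ u‖ ≤ (1 - a * ((1 - M.γ) * M.dmin)) * ‖u‖ := by
  have hγ := M.γ_lt_one
  have hγ0 := M.γ_nonneg
  have hd1 : M.dmin ≤ 1 := (dmin_le_lawInf (Classical.arbitrary _)).trans (hM.lawInf_le_one _)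
  have hd := hM.dmin_pos
  have hu := norm_nonneg u
  have h0 : 0 ≤ 1 - a * ((1 - M.γ) * M.dmin) := by
    have : (1 - M.γ) * M.dmin ≤ 1 := by nlinarith
    nlinarith [mul_nonneg (sub_nonneg.2 hγ.le) hd.le]
  refine (pi_norm_le_iff_of_nonneg (mul_nonneg h0 hu)).2 fun x => ?_
  have h1 := abs_le.1 (abs_gamma_mul_P_greedy_le (M := M) u x)
  have h2 := abs_le.1 (norm_le_pi_norm u x)
  have h3 := hM.lawInf_le_one x
  have h4 := dmin_le_lawInf (M := M) x
  rw [Pi.add_apply, Pi.smul_apply, T_mulVec, smul_eq_mul, Real.norm_eq_abs]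
  set p := M.γ * (M.P *ᵥ (M.greedyMatrix M.Qstar *ᵥ u)) x
  set d := M.lawInf x
  have had : 0 ≤ 1 - a * d := by nlinarith
  have had0 : 0 ≤ a * d := mul_nonneg ha (hd.le.trans h4)
  have h5 : a * d * (M.γ * ‖u‖) + (1 - a * d) * ‖u‖ ≤ (1 - a * ((1 - M.γ) * M.dmin)) * ‖u‖ := by
    have : a * M.dmin * ((1 - M.γ) * ‖u‖) ≤ a * d * ((1 - M.γ) * ‖u‖) := by
      have := mul_nonneg (sub_nonneg.2 hγ.le) hu
      gcongr
    linarith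
  have e : u x + a * (d * (p - u x)) = a * d * p + (1 - a * d) * u x := by ring
  rw [e, abs_le]
  constructor
  · have := mul_le_mul_of_nonneg_left h1.1 had0
    have := mul_le_mul_of_nonneg_left h2.1 had
    linarith
  · have := mul_le_mul_of_nonneg_left h1.2 had0
    have := mul_le_mul_of_nonneg_left h2.2 had
    linarith

lemma IsErgodic.rate_pos (hM : M.IsErgodic) : 0 < (1 - M.γ) * M.dmin :=
  mul_pos (sub_pos.2 M.γ_lt_one) hM.dmin_pos

lemma IsErgodic.rate_le_one (hM : M.IsErgodic) : (1 - M.γ) * M.dmin ≤ 1 := by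
  have hd1 : M.dmin ≤ 1 := (dmin_le_lawInf (Classical.arbitrary _)).trans (hM.lawInf_le_one _)
  nlinarith [M.γ_nonneg, hM.dmin_pos]

lemma IsErgodic.isSupDissipative_T (hM : M.IsErgodic) :
    IsSupDissipative M.T ((1 - M.γ) * M.dmin) where
  pos := hM.rate_pos
  norm_add_le u := by simpa using hM.norm_add_smul_T_le zero_le_one le_rfl u
  le_norm_sub u := by
    -- At a coordinate of maximal modulus the diagonal term `(1 + d) u x` outweighs the off-diagonal
    -- one, which is at most `d γ ‖u‖`.
    obtain ⟨x, hmax⟩ := Finite.exists_max fun x => |u x|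
    have hx : |u x| = ‖u‖ := le_antisymm (norm_le_pi_norm u x)
      ((pi_norm_le_iff_of_nonneg (abs_nonneg _)).2 hmax)
    refine le_trans ?_ (norm_le_pi_norm _ x)
    rw [Pi.sub_apply, T_mulVec]
    have h1 := abs_gamma_mul_P_greedy_le (M := M) u x
    have h4 := dmin_le_lawInf (M := M) x
    have hd := hM.dmin_pos
    set p := M.γ * (M.P *ᵥ (M.greedyMatrix M.Qstar *ᵥ u)) x
    set d := M.lawInf x
    have e : u x - d * (p - u x) = (1 + d) * u x - d * p := by ring
    have hd0 : 0 < d := hd.trans_le h4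
    have h5 : |d * p| ≤ d * (M.γ * ‖u‖) := by
      rw [abs_mul, abs_of_pos hd0]; exact mul_le_mul_of_nonneg_left h1 hd0.le
    have h6 : |(1 + d) * u x| = (1 + d) * ‖u‖ := by
      rw [abs_mul, abs_of_pos (by linarith), hx]
    rw [e, Real.norm_eq_abs]
    have h7 := abs_sub_abs_le_abs_sub ((1 + d) * u x) (d * p)
    have h8 : M.dmin * ((1 - M.γ) * ‖u‖) ≤ d * ((1 - M.γ) * ‖u‖) := by
      have := mul_nonneg (sub_nonneg.2 M.γ_lt_one.le) (norm_nonneg u)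
      gcongr
    linarith

lemma IsErgodic.dmax_pos (hM : M.IsErgodic) : 0 < M.dmax :=
  (hM.lawInf_pos (Classical.arbitrary _)).trans_le (lawInf_le_dmax _)

lemma IsErgodic.norm_T_mulVec_le (hM : M.IsErgodic) (u : S × A → ℝ) :
    ‖M.T *ᵥ u‖ ≤ 2 * M.dmax * ‖u‖ := by
  have hd := hM.dmax_pos
  refine (pi_norm_le_iff_of_nonneg (by positivity)).2 fun x => ?_
  rw [T_mulVec, Real.norm_eq_abs, abs_mul, abs_of_pos (hM.lawInf_pos x)]
  have h1 := abs_gamma_mul_P_greedy_le (M := M) u x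
  have h2 : |u x| ≤ ‖u‖ := norm_le_pi_norm u x
  have h3 : |M.γ * (M.P *ᵥ (M.greedyMatrix M.Qstar *ᵥ u)) x - u x| ≤ 2 * ‖u‖ := by
    refine (abs_sub _ _).trans ?_
    nlinarith [M.γ_lt_one, norm_nonneg u]
  calc _ ≤ M.dmax * (2 * ‖u‖) := mul_le_mul (lawInf_le_dmax x) h3 (abs_nonneg _) hd.le
    _ = _ := by ring

lemma IsErgodic.specNorm_T_le (hM : M.IsErgodic) : specNorm M.T ≤ 2 * √M.size * M.dmax := by
  have hd := hM.dmax_pos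
  refine specNorm_le (by positivity) fun v => (l2norm_le _).trans ?_
  rw [← size_eq_card (M := M)]
  calc √M.size * ‖M.T *ᵥ v‖ ≤ √M.size * (2 * M.dmax * l2norm v) := by
        gcongr
        refine (hM.norm_T_mulVec_le v).trans ?_
        gcongr
        exact norm_le_l2norm v
    _ = _ := by ring

lemma IsErgodic.existsUnique_isLyapunov (hM : M.IsErgodic) :
    ∃! G : Matrix (S × A) (S × A) ℝ, M.IsLyapunov G := by
  obtain ⟨G, hG⟩ := hM.isSupDissipative_T.exists_lyapunov hM.rate_le_one
  refine ⟨G, ⟨hM.isSupDissipative_T.posDef_of_lyapunov hM.rate_le_one hG, hG⟩, fun H hH => ?_⟩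
  rw [← sub_eq_zero]
  refine hM.isSupDissipative_T.eq_zero_of_lyapunov hM.rate_le_one ?_
  rw [Matrix.sub_mul, Matrix.mul_sub]
  calc H * M.T - G * M.T + (M.Tᵀ * H - M.Tᵀ * G)
      = (H * M.T + M.Tᵀ * H) - (G * M.T + M.Tᵀ * G) := by abel
    _ = 0 := by rw [hH.equation, hG, sub_self]

namespace IsLyapunov

variable {G : Matrix (S × A) (S × A) ℝ}

omit [Nonempty S] [Nonempty A] in
lemma dotProduct_equation (hG : M.IsLyapunov G) (v : S × A → ℝ) :
    2 * (v ⬝ᵥ G *ᵥ (M.T *ᵥ v)) = -l2norm v ^ 2 := by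
  have hsymm : Gᵀ = G := by
    have h := hG.posDef.isHermitian
    rwa [Matrix.IsHermitian, Matrix.conjTranspose_eq_transpose_of_trivial] at h
  have h := congrArg (fun N => v ⬝ᵥ N *ᵥ v) hG.equation
  simp only [Matrix.add_mulVec, dotProduct_add, ← Matrix.mulVec_mulVec, Matrix.neg_mulVec,
    Matrix.one_mulVec, dotProduct_neg] at h
  have e : v ⬝ᵥ M.Tᵀ *ᵥ G *ᵥ v = v ⬝ᵥ G *ᵥ (M.T *ᵥ v) := by
    rw [Matrix.dotProduct_mulVec v M.Tᵀ, Matrix.vecMul_transpose, dotProduct_comm,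
      Matrix.dotProduct_mulVec v G, ← Matrix.mulVec_transpose G, hsymm]
  rw [e, ← l2norm_sq] at h
  linarith

omit [Nonempty S] [Nonempty A] in
lemma dotProduct_mulVec_nonneg (hG : M.IsLyapunov G) (v : S × A → ℝ) : 0 ≤ v ⬝ᵥ G *ᵥ v := by
  simpa using hG.posDef.posSemidef.dotProduct_mulVec_nonneg v

/-- For `H = G` the right side `-I` has `‖u‖₂² ≤ n ‖u‖_∞²`, so `c = n` in
`quadratic_le_of_lyapunov`. -/
lemma specNorm_le (hG : M.IsLyapunov G) (hM : M.IsErgodic) :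
    specNorm G ≤ 2 * M.size / ((1 - M.γ) * M.dmin) := by
  have hδ := hM.rate_pos
  have hn : 0 ≤ M.size := zero_le_one.trans one_le_size
  refine specNorm_le_of_quadratic_le hG.posDef.posSemidef (by positivity) fun v => ?_
  refine (hM.isSupDissipative_T.quadratic_le_of_lyapunov hM.rate_le_one hn (H := G)
    (fun u => ?_) v).trans ?_
  · rw [hG.equation, Matrix.neg_mulVec, Matrix.one_mulVec, dotProduct_neg, neg_neg, ← l2norm_sq,
      size_eq_card]
    exact l2norm_sq_le u
  · gcongr
    exact norm_le_l2norm v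

/-- Test the equation on the constant vector: `T 1 = -(1-γ) μ_∞` has Euclidean norm at most 1. This
makes `4 ‖G‖` a legitimate positive `θ` and later forces `ξ ≥ 1`. -/
lemma half_le_specNorm (hG : M.IsLyapunov G) (hM : M.IsErgodic) : 1 / 2 ≤ specNorm G := by
  have h := hG.dotProduct_equation 1
  have hT : M.T *ᵥ 1 = fun x => (M.γ - 1) * M.lawInf x := by
    ext x
    rw [T_mulVec]
    have : (M.P *ᵥ (M.greedyMatrix M.Qstar *ᵥ 1)) x = 1 := by
      have : M.greedyMatrix M.Qstar *ᵥ 1 = fun _ => 1 := by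
        ext s; rw [greedyMatrix_mulVec]; rfl
      rw [this]
      simp [P, Matrix.mulVec, dotProduct, M.trans_sum]
    rw [this, Pi.one_apply]; ring
  have h1 : l2norm (M.T *ᵥ 1) ≤ 1 := by
    refine (l2norm_le_sum_abs _).trans ?_
    rw [hT]
    simp only [abs_mul, ← Finset.mul_sum, abs_of_pos (hM.lawInf_pos _), hM.sum_lawInf, mul_one]
    rw [abs_le]; constructor <;> linarith [M.γ_lt_one, M.γ_nonneg]
  have h2 := (abs_le.1 (abs_dotProduct_mulVec_le G 1 (M.T *ᵥ 1))).1
  have hone : 1 ≤ l2norm (1 : S × A → ℝ) := by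
    have := norm_le_l2norm (1 : S × A → ℝ)
    simpa using this
  have hs := specNorm_nonneg G
  have h3 : l2norm (1 : S × A → ℝ) * (specNorm G * l2norm (M.T *ᵥ 1)) ≤
      l2norm (1 : S × A → ℝ) * (specNorm G * 1) := by gcongr
  have h4 : l2norm (1 : S × A → ℝ) * 1 ≤ l2norm (1 : S × A → ℝ) * (2 * specNorm G) := by
    nlinarith
  have := le_of_mul_le_mul_left h4 (by linarith)
  linarith

/-- The Lyapunov operator commutes with `H ↦ Tᵀ H T`, so it sends `t² G - Tᵀ G T` to `Tᵀ T - t² I ≤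
0`; the matrix is therefore positive semidefinite. -/
lemma dotProduct_T_le (hG : M.IsLyapunov G) (hM : M.IsErgodic) (v : S × A → ℝ) :
    (M.T *ᵥ v) ⬝ᵥ G *ᵥ (M.T *ᵥ v) ≤ specNorm M.T ^ 2 * (v ⬝ᵥ G *ᵥ v) := by
  set t := specNorm M.T
  set H : Matrix (S × A) (S × A) ℝ := t ^ 2 • G - M.Tᵀ * G * M.T with hH
  have e : H * M.T + M.Tᵀ * H = M.Tᵀ * M.T - t ^ 2 • 1 := by
    have : H * M.T + M.Tᵀ * H = t ^ 2 • (G * M.T + M.Tᵀ * G)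
        - M.Tᵀ * (G * M.T + M.Tᵀ * G) * M.T := by
      rw [hH]; simp only [Matrix.sub_mul, Matrix.mul_sub, Matrix.mul_add, Matrix.add_mul,
        Matrix.smul_mul, Matrix.mul_smul, smul_add, Matrix.mul_assoc]; abel
    rw [this, hG.equation]
    simp [sub_eq_add_neg, add_comm]
  have h := hM.isSupDissipative_T.quadratic_nonneg_of_lyapunov hM.rate_le_one (H := H)
    (fun u => by
      rw [e, Matrix.sub_mulVec, dotProduct_sub, ← Matrix.mulVec_mulVec, Matrix.smul_mulVec,
        Matrix.one_mulVec, dotProduct_smul, Matrix.dotProduct_mulVec, Matrix.vecMul_transpose,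
        ← l2norm_sq, ← l2norm_sq, smul_eq_mul, ← mul_pow, sub_nonpos]
      exact pow_le_pow_left₀ (l2norm_nonneg _) (l2norm_mulVec_le _ _) 2) v
  rw [hH, Matrix.sub_mulVec, dotProduct_sub, Matrix.smul_mulVec, dotProduct_smul, smul_eq_mul,
    Matrix.mul_assoc, ← Matrix.mulVec_mulVec, Matrix.dotProduct_mulVec v M.Tᵀ,
    Matrix.vecMul_transpose,
    ← Matrix.mulVec_mulVec] at h
  linarith

omit [Nonempty S] [Nonempty A] in
lemma B_mulVec_sqrt (hG : M.IsLyapunov G) (v : S × A → ℝ) :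
    M.B G *ᵥ (CFC.sqrt G *ᵥ v) = CFC.sqrt G *ᵥ (M.T *ᵥ v) := by
  rw [B, Matrix.mulVec_mulVec, Matrix.mul_assoc, Matrix.nonsing_inv_mul _ (isUnit_sqrt hG.posDef),
    Matrix.mul_one, Matrix.mulVec_mulVec]

omit [Nonempty S] [Nonempty A] in
lemma dotProduct_T_le_B (hG : M.IsLyapunov G) (v : S × A → ℝ) :
    (M.T *ᵥ v) ⬝ᵥ G *ᵥ (M.T *ᵥ v) ≤ specNorm (M.B G) ^ 2 * (v ⬝ᵥ G *ᵥ v) := by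
  have hp := hG.posDef.posSemidef
  rw [← l2norm_sqrt_mulVec_sq hp, ← l2norm_sqrt_mulVec_sq hp, ← hG.B_mulVec_sqrt, ← mul_pow]
  exact pow_le_pow_left₀ (l2norm_nonneg _) (l2norm_mulVec_le _ _) 2

lemma specNorm_B_le (hG : M.IsLyapunov G) (hM : M.IsErgodic) :
    specNorm (M.B G) ≤ specNorm M.T := by
  have hp := hG.posDef.posSemidef
  refine _root_.specNorm_le (specNorm_nonneg _) fun v => ?_
  obtain ⟨u, rfl⟩ : ∃ u, CFC.sqrt G *ᵥ u = v := ⟨(CFC.sqrt G)⁻¹ *ᵥ v, by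
    rw [Matrix.mulVec_mulVec, Matrix.mul_nonsing_inv _ (isUnit_sqrt hG.posDef),
      Matrix.one_mulVec]⟩
  refine le_of_sq_le_sq ?_ (mul_nonneg (specNorm_nonneg _) (l2norm_nonneg _))
  rw [hG.B_mulVec_sqrt, mul_pow, l2norm_sqrt_mulVec_sq hp, l2norm_sqrt_mulVec_sq hp]
  exact hG.dotProduct_T_le hM u

/-- The step-size parameters of the theorem are admissible. -/
lemma isAdmissible (hG : M.IsLyapunov G) (hM : M.IsErgodic) :
    M.IsAdmissible G 128 (4 * specNorm G)
      (max (4 * specNorm G) (8 * specNorm G ^ 2 * specNorm (M.B G) ^ 2)) := by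
  have hl := hG.half_le_specNorm hM
  have hle := hG.specNorm_le hM
  have hB := (hG.specNorm_B_le hM).trans hM.specNorm_T_le
  have hB0 := specNorm_nonneg (M.B G)
  set l := specNorm G
  set b := specNorm (M.B G)
  have hl0 : 0 < l := by linarith
  have hn : 1 ≤ M.size := one_le_size
  have hδ := hM.rate_pos
  have hδ1 := hM.rate_le_one
  have hdx := hM.one_le_size_mul_dmax
  have hdx0 := hM.dmax_pos
  set δ := (1 - M.γ) * M.dmin
  have hpow : M.size ^ (9 / 2 : ℝ) = M.size ^ 4 * √M.size := by
    rw [Real.sqrt_eq_rpow, ← Real.rpow_natCast, ← Real.rpow_add (by linarith)]; norm_num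
  have hs1 : 1 ≤ √M.size := Real.one_le_sqrt.2 hn
  have e1 : M.size ^ (9 / 2 : ℝ) * M.dmax ^ 2 / ((1 - M.γ) ^ 2 * M.dmin ^ 2) =
      M.size ^ 4 * √M.size * M.dmax ^ 2 / δ ^ 2 := by rw [hpow, mul_pow]
  have hn3 : M.size ^ 3 ≤ M.size ^ 4 * √M.size := by
    calc M.size ^ 3 ≤ M.size ^ 4 := pow_le_pow_right₀ hn (by norm_num)
      _ ≤ _ := le_mul_of_one_le_right (by positivity) hs1
  have hbsq : b ^ 2 ≤ 4 * M.size * M.dmax ^ 2 := by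
    calc b ^ 2 ≤ (2 * √M.size * M.dmax) ^ 2 := pow_le_pow_left₀ hB0 hB 2
      _ = _ := by rw [mul_pow, mul_pow, Real.sq_sqrt (by linarith)]; ring
  -- `η = 1/(2l)` uses half of the budget `1/l` and gives `η θ = 2`; the second entry of the maximum
  -- keeps `α_0 b²` within the other half.
  refine ⟨by positivity, le_max_left _ _, ⟨1 / (2 * l), ?_, ?_⟩, ?_, ?_⟩
  · exact le_of_eq (by field_simp; norm_num)
  · have hξ : 0 < max (4 * l) (8 * l ^ 2 * b ^ 2) := lt_max_of_lt_left (by linarith)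
    have h : stepSize (4 * l) (max (4 * l) (8 * l ^ 2 * b ^ 2)) 0 * b ^ 2 ≤ 1 / (2 * l) := by
      rw [stepSize, Nat.cast_zero, zero_add, div_mul_eq_mul_div, div_le_div_iff₀ hξ (by positivity)]
      refine le_trans (le_of_eq ?_) (mul_le_mul_of_nonneg_left (le_max_right _ _) zero_le_one)
      ring
    calc _ ≤ (1 / (2 * l) + 1 / (2 * l)) * l := by gcongr
      _ = 1 := by field_simp; norm_num
  · calc 4 * l ≤ 4 * (2 * M.size / δ) := by gcongr
      _ = 8 * (M.size / δ) := by ring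
      _ ≤ 128 * (M.size / δ) := by gcongr; norm_num
  · rw [e1]
    refine max_le ?_ ?_
    · calc 4 * l ≤ 4 * (2 * M.size / δ) := by gcongr
        _ = 8 * (M.size / δ) := by ring
        _ ≤ 128 * (M.size ^ 4 * √M.size * M.dmax ^ 2 / δ ^ 2) := by
          -- `n d_max ≥ 1` pays for the factor `d_max²`.
          have h1 : M.size ≤ M.size ^ 4 * √M.size * M.dmax ^ 2 := by
            calc M.size = M.size * 1 := (mul_one _).symm
              _ ≤ M.size * (M.size * M.dmax) ^ 2 := by gcongr; exact one_le_pow₀ hdx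
              _ = M.size ^ 3 * M.dmax ^ 2 := by ring
              _ ≤ _ := by gcongr
          have h2 : δ ^ 2 ≤ δ := by nlinarith
          have h3 := div_le_div₀ (by positivity) h1 (by positivity) h2
          have h4 : 0 ≤ M.size / δ := by positivity
          linarith
    -- This is the source of the constant `128 = 8 · 2² · 4`.
    · calc 8 * l ^ 2 * b ^ 2 ≤ 8 * (2 * M.size / δ) ^ 2 * (4 * M.size * M.dmax ^ 2) := by gcongr
        _ = 128 * (M.size ^ 3 * M.dmax ^ 2 / δ ^ 2) := by field_simp; ring
        _ ≤ _ := by gcongr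

end IsLyapunov

end QModel

/-! ### Pathwise bounds on the iterates and the noise -/

namespace QModel

section IterateBounds

variable {S A : Type*} [Fintype S] [Fintype A] [DecidableEq S] [DecidableEq A] (M : QModel S A)

/-- The temporal difference at `x` when the next state is `s'`. -/
noncomputable def td (Q : S × A → ℝ) (x : S × A) (s' : S) : ℝ :=
  M.reward x.1 x.2 s' + M.γ * (M.greedyMatrix Q *ᵥ Q) s' - Q x

/-- The mean temporal difference at `x`. -/
noncomputable def tdMean (Q : S × A → ℝ) (x : S × A) : ℝ := ∑ s', M.trans x.1 x.2 s' * M.td Q x s'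

/-- A bound on the Q-functions. -/
noncomputable def horizon : ℝ := 1 / (1 - M.γ)

/-- A bound on the error of the lower comparison system. -/
noncomputable def errBound : ℝ := 4 * M.horizon / ((1 - M.γ) * M.dmin)

variable {M}

omit [DecidableEq S] [DecidableEq A] in
lemma abs_sum_trans_mul_le {f : S → ℝ} {b : ℝ} (x : S × A) (hf : ∀ s, |f s| ≤ b) :
    |∑ s', M.trans x.1 x.2 s' * f s'| ≤ b :=
  abs_P_mulVec_le hf x

lemma noise_apply (Q : S × A → ℝ) (x : S × A) (s' : S) (y : S × A) :
    M.noise Q x s' y = (Pi.single x (M.td Q x s') : S × A → ℝ) y - M.lawInf y * M.tdMean Q y := by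
  have h : M.tdMean Q y = M.R y + M.γ * (M.P *ᵥ (M.greedyMatrix Q *ᵥ Q)) y - Q y := by
    simp only [tdMean, td, mul_sub, mul_add, Finset.sum_sub_distrib, Finset.sum_add_distrib,
      ← Finset.sum_mul, M.trans_sum, one_mul, R]
    congr 2
    change _ = M.γ * ∑ s', M.trans y.1 y.2 s' * (M.greedyMatrix Q *ᵥ Q) s'
    rw [Finset.mul_sum]
    exact Finset.sum_congr rfl fun s _ => mul_left_comm _ _ _
  simp only [noise, Pi.sub_apply, Pi.add_apply, Pi.smul_apply, D_mul_P_mul_mulVec, smul_eq_mul]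
  simp only [D, Matrix.mulVec_diagonal]
  rw [h, td]
  ring

omit [DecidableEq S] [DecidableEq A] in
lemma one_le_horizon : 1 ≤ M.horizon := by
  rw [horizon, le_div_iff₀ (sub_pos.2 M.γ_lt_one)]
  linarith [M.γ_nonneg]

omit [DecidableEq S] [DecidableEq A] in
lemma horizon_eq : 1 + M.γ * M.horizon = M.horizon := by
  have := (sub_pos.2 M.γ_lt_one).ne'
  rw [horizon, mul_one_div, eq_div_iff this, add_mul, div_mul_cancel₀ _ this]
  ring

lemma iSup_eq_greedy (Q : S × A → ℝ) (s : S) :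
    ⨆ a, Q (s, a) = (M.greedyMatrix Q *ᵥ Q) s := by
  rw [greedyMatrix_mulVec]
  have : Nonempty A := ⟨M.greedy Q s⟩
  exact le_antisymm (ciSup_le fun a => M.greedy_spec Q s a)
    (le_ciSup (f := fun a => Q (s, a)) (Set.finite_range _).bddAbove _)

lemma abs_td_le {Q : S × A → ℝ} (hQ : ‖Q‖ ≤ M.horizon) (x : S × A) (s' : S) :
    |M.td Q x s'| ≤ 2 * M.horizon := by
  have h1 := abs_le.1 (M.reward_bound x.1 x.2 s')
  have h2 := abs_le.1 ((norm_le_pi_norm Q x).trans hQ)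
  have h3 := abs_le.1 ((abs_greedyMatrix_mulVec_le (M := M) Q Q s').trans hQ)
  have h4 := mul_le_mul_of_nonneg_left h3.1 M.γ_nonneg
  have h5 := mul_le_mul_of_nonneg_left h3.2 M.γ_nonneg
  have h6 := M.horizon_eq
  rw [td, abs_le]
  constructor <;> linarith

lemma abs_td_sub_le (Q Q' : S × A → ℝ) (x : S × A) (s' : S) :
    |M.td Q x s' - M.td Q' x s'| ≤ 2 * ‖Q - Q'‖ := by
  have hn := norm_nonneg (Q - Q')
  have h1 : ∀ y, |Q y - Q' y| ≤ ‖Q - Q'‖ := fun y => norm_le_pi_norm (Q - Q') y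
  have h2 : |(M.greedyMatrix Q *ᵥ Q) s' - (M.greedyMatrix Q' *ᵥ Q') s'| ≤ ‖Q - Q'‖ := by
    rw [greedyMatrix_mulVec, greedyMatrix_mulVec, abs_le]
    have ha := abs_le.1 (h1 (s', M.greedy Q s'))
    have hb := abs_le.1 (h1 (s', M.greedy Q' s'))
    -- The greedy actions of `Q` and `Q'` may differ; optimality of each for its own function still
    -- makes the maximum nonexpansive.
    have hc := M.greedy_spec Q s' (M.greedy Q' s')
    have hd := M.greedy_spec Q' s' (M.greedy Q s')
    constructor <;> linarith
  have e : M.td Q x s' - M.td Q' x s' =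
      M.γ * ((M.greedyMatrix Q *ᵥ Q) s' - (M.greedyMatrix Q' *ᵥ Q') s') - (Q x - Q' x) := by
    rw [td, td]; ring
  rw [e]
  refine (abs_sub _ _).trans ?_
  rw [abs_mul, abs_of_nonneg M.γ_nonneg]
  have h3 := mul_le_mul M.γ_lt_one.le h2 (abs_nonneg _) zero_le_one
  linarith [h1 x]

lemma abs_tdMean_le {Q : S × A → ℝ} (hQ : ‖Q‖ ≤ M.horizon) (x : S × A) :
    |M.tdMean Q x| ≤ 2 * M.horizon :=
  abs_sum_trans_mul_le x (abs_td_le hQ x)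

lemma abs_tdMean_sub_le (Q Q' : S × A → ℝ) (x : S × A) :
    |M.tdMean Q x - M.tdMean Q' x| ≤ 2 * ‖Q - Q'‖ := by
  rw [tdMean, tdMean, ← Finset.sum_sub_distrib]
  simp only [← mul_sub]
  exact abs_sum_trans_mul_le x (abs_td_sub_le Q Q' x)

/-- Every policy has a discounted sum of rewards bounded by 1. No Bellman equation is needed: `Q*`
enters the proof only through this bound and its greedy policy. -/
lemma abs_Qstar_le [Nonempty A] (x : S × A) : |M.Qstar x| ≤ M.horizon := by
  have hpi : ∀ (π : S → A), |M.policyQ π x| ≤ M.horizon := by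
    intro π
    have hR : ∀ y, |M.R y| ≤ 1 := fun y =>
      abs_sum_trans_mul_le y fun s => M.reward_bound y.1 y.2 s
    have hpow : ∀ (t : ℕ) (y : S × A), |(((M.P * policyMatrix π) ^ t) *ᵥ M.R) y| ≤ 1 := by
      intro t
      induction t with
      | zero => simpa using hR
      | succ t ih =>
        intro y
        rw [pow_succ', ← Matrix.mulVec_mulVec, ← Matrix.mulVec_mulVec]
        refine abs_P_mulVec_le (fun s => ?_) y
        have : (policyMatrix π *ᵥ ((M.P * policyMatrix π) ^ t *ᵥ M.R)) s =
            ((M.P * policyMatrix π) ^ t *ᵥ M.R) (s, π s) := by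
          simp [policyMatrix, Matrix.mulVec, dotProduct]
        rw [this]
        exact ih _
    rw [policyQ, horizon, one_div, ← Real.norm_eq_abs]
    refine tsum_of_norm_bounded (hasSum_geometric_of_lt_one M.γ_nonneg M.γ_lt_one) fun t => ?_
    rw [norm_mul, norm_pow, Real.norm_of_nonneg M.γ_nonneg]
    exact mul_le_of_le_one_right (pow_nonneg M.γ_nonneg t) (hpow t x)
  obtain ⟨π, hπ⟩ := exists_eq_ciSup_of_finite (f := fun π => M.policyQ π x)
  rw [Qstar, ← hπ]
  exact hpi π

variable {θ ξ : ℝ}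

lemma stepSize_nonneg (hθ : 0 ≤ θ) (hξ : 0 ≤ ξ) (k : ℕ) : 0 ≤ stepSize θ ξ k :=
  div_nonneg hθ (add_nonneg (Nat.cast_nonneg k) hξ)

lemma stepSize_le_one (hθ : 0 < θ) (hξ : θ ≤ ξ) (k : ℕ) : stepSize θ ξ k ≤ 1 := by
  have : (0 : ℝ) ≤ k := Nat.cast_nonneg k
  rw [stepSize, div_le_one (by linarith)]
  linarith

lemma iterate_succ (θ ξ : ℝ) (x : ℕ → S × A) (k : ℕ) : M.iterate θ ξ x (k + 1) =
    M.iterate θ ξ x k + stepSize θ ξ k •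
      (Pi.single (x k) (M.td (M.iterate θ ξ x k) (x k) (x (k + 1)).1) : S × A → ℝ) := by
  ext y
  rw [iterate, iSup_eq_greedy, ← td, Pi.add_apply, Pi.smul_apply]
  by_cases h : y = x k
  · subst h; simp
  · simp [h]

/-- As `α_k ≤ 1`, an update is a convex combination of the old entry and a target bounded by `1 + γ
h = h`. -/
lemma norm_iterate_le (hθ : 0 < θ) (hξ : θ ≤ ξ) (x : ℕ → S × A) (k : ℕ) :
    ‖M.iterate θ ξ x k‖ ≤ M.horizon := by
  have hh := M.one_le_horizon
  induction k with
  | zero =>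
    refine (pi_norm_le_iff_of_nonneg (by linarith)).2 fun y => ?_
    exact (M.Q₀_bound y).trans hh
  | succ k ih =>
    refine (pi_norm_le_iff_of_nonneg (by linarith)).2 fun y => ?_
    rw [iterate_succ, Pi.add_apply, Pi.smul_apply]
    by_cases h : y = x k
    · subst h
      set Q := M.iterate θ ξ x k
      rw [Pi.single_eq_same, td, Real.norm_eq_abs, smul_eq_mul]
      have ha := stepSize_nonneg (ξ := ξ) hθ.le (hθ.le.trans hξ) k
      have ha1 := stepSize_le_one hθ hξ k
      set α := stepSize θ ξ k
      have h1 := abs_le.1 (M.reward_bound (x k).1 (x k).2 (x (k + 1)).1)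
      have h2 := abs_le.1 ((norm_le_pi_norm Q (x k)).trans ih)
      have h3 := abs_le.1 ((abs_greedyMatrix_mulVec_le (M := M) Q Q (x (k + 1)).1).trans ih)
      have h4 := mul_le_mul_of_nonneg_left h3.1 M.γ_nonneg
      have h5 := mul_le_mul_of_nonneg_left h3.2 M.γ_nonneg
      have h6 := M.horizon_eq
      set g := M.γ * (M.greedyMatrix Q *ᵥ Q) (x (k + 1)).1
      set r := M.reward (x k).1 (x k).2 (x (k + 1)).1
      have e : Q (x k) + α * (r + g - Q (x k)) = (1 - α) * Q (x k) + α * (r + g) := by ring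
      rw [e, abs_le]
      constructor
      · have := mul_le_mul_of_nonneg_left h2.1 (sub_nonneg.2 ha1)
        have : α * (-M.horizon) ≤ α * (r + g) := mul_le_mul_of_nonneg_left (by linarith) ha
        linarith
      · have := mul_le_mul_of_nonneg_left h2.2 (sub_nonneg.2 ha1)
        have : α * (r + g) ≤ α * M.horizon := mul_le_mul_of_nonneg_left (by linarith) ha
        linarith
    · simpa [h] using (norm_le_pi_norm _ y).trans ih

lemma norm_iterate_succ_sub_le (hθ : 0 < θ) (hξ : θ ≤ ξ) (x : ℕ → S × A) (k : ℕ) :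
    ‖M.iterate θ ξ x (k + 1) - M.iterate θ ξ x k‖ ≤ stepSize θ ξ k * (2 * M.horizon) := by
  have ha := stepSize_nonneg (ξ := ξ) hθ.le (hθ.le.trans hξ) k
  rw [iterate_succ, add_sub_cancel_left, norm_smul, Real.norm_of_nonneg ha]
  refine mul_le_mul_of_nonneg_left ?_ ha
  have hh := M.one_le_horizon
  refine (pi_norm_le_iff_of_nonneg (by linarith)).2 fun y => ?_
  by_cases h : y = x k
  · subst h
    rw [Pi.single_eq_same]
    exact abs_td_le (norm_iterate_le hθ hξ x k) _ _
  · rw [Pi.single_eq_of_ne h, norm_zero]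
    linarith

lemma lower_succ_sub (θ ξ : ℝ) (x : ℕ → S × A) (k : ℕ) :
    M.lower θ ξ x (k + 1) - M.Qstar = (M.lower θ ξ x k - M.Qstar)
      + stepSize θ ξ k • M.T *ᵥ (M.lower θ ξ x k - M.Qstar)
      + stepSize θ ξ k • M.noise (M.iterate θ ξ x k) (x k) (x (k + 1)).1 := by
  rw [lower, Matrix.add_mulVec, Matrix.one_mulVec, Matrix.smul_mulVec]
  abel

lemma iterate_congr (θ ξ : ℝ) {x y : ℕ → S × A} {k : ℕ} (h : ∀ i ≤ k, x i = y i) :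
    M.iterate θ ξ x k = M.iterate θ ξ y k := by
  induction k with
  | zero => rfl
  | succ k ih =>
    rw [iterate_succ, iterate_succ, ih fun i hi => h i (by omega), h k (by omega),
      h (k + 1) le_rfl]

lemma lower_congr (θ ξ : ℝ) {x y : ℕ → S × A} {k : ℕ} (h : ∀ i ≤ k, x i = y i) :
    M.lower θ ξ x k = M.lower θ ξ y k := by
  induction k with
  | zero => rfl
  | succ k ih =>
    rw [← sub_left_inj (a := M.Qstar), lower_succ_sub, lower_succ_sub,
      ih fun i hi => h i (by omega), h k (by omega), h (k + 1) le_rfl,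
      iterate_congr θ ξ fun i hi => h i (by omega : i ≤ k + 1)]

section Ergodic

variable [Nonempty S] [Nonempty A]

/-- A point mass and a `μ_∞`-weighted vector each have `ℓ¹` norm at most `b`, so noise bounds carry
no power of the dimension. -/
lemma IsErgodic.sum_abs_single_sub_le (hM : M.IsErgodic) (x : S × A) {a b : ℝ} {f : S × A → ℝ}
    (ha : |a| ≤ b) (hf : ∀ y, |f y| ≤ b) :
    ∑ y, |(Pi.single x a : S × A → ℝ) y - M.lawInf y * f y| ≤ 2 * b := by
  calc _ ≤ ∑ y, (|(Pi.single x a : S × A → ℝ) y| + M.lawInf y * b) :=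
        Finset.sum_le_sum fun y _ => by
          refine (abs_sub _ _).trans ?_
          rw [abs_mul, abs_of_pos (hM.lawInf_pos y)]
          gcongr
          · exact (hM.lawInf_pos y).le
          · exact hf y
    _ = |a| + b := by
        rw [Finset.sum_add_distrib, ← Finset.sum_mul, hM.sum_lawInf, one_mul]
        congr 1
        rw [Finset.sum_eq_single x (fun y _ hy => by simp [hy]) (by simp)]
        simp
    _ ≤ 2 * b := by linarith

lemma IsErgodic.l2norm_noise_le (hM : M.IsErgodic) {Q : S × A → ℝ} (hQ : ‖Q‖ ≤ M.horizon)
    (x : S × A) (s' : S) : l2norm (M.noise Q x s') ≤ 4 * M.horizon := by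
  refine (l2norm_le_sum_abs _).trans ?_
  simp only [noise_apply]
  refine (hM.sum_abs_single_sub_le x (abs_td_le hQ x s') (abs_tdMean_le hQ)).trans ?_
  linarith

lemma IsErgodic.l2norm_noise_sub_le (hM : M.IsErgodic) (Q Q' : S × A → ℝ)
    (x : S × A) (s' : S) : l2norm (M.noise Q x s' - M.noise Q' x s') ≤ 4 * ‖Q - Q'‖ := by
  refine (l2norm_le_sum_abs _).trans ?_
  have e : ∀ y, (M.noise Q x s' - M.noise Q' x s') y =
      (Pi.single x (M.td Q x s' - M.td Q' x s') : S × A → ℝ) y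
        - M.lawInf y * (M.tdMean Q y - M.tdMean Q' y) := fun y => by
    rw [Pi.sub_apply, noise_apply, noise_apply, Pi.single_sub, Pi.sub_apply]; ring
  simp only [e]
  refine (hM.sum_abs_single_sub_le x (abs_td_sub_le Q Q' x s') (abs_tdMean_sub_le Q Q')).trans ?_
  linarith

/-- The noise is centred under the stationary law. -/
lemma IsErgodic.sum_lawInf_mul_noise (hM : M.IsErgodic) (Q : S × A → ℝ) (y : S × A) :
    ∑ x, M.lawInf x * ∑ s', M.trans x.1 x.2 s' * M.noise Q x s' y = 0 := by
  have h : ∀ x, ∑ s', M.trans x.1 x.2 s' * M.noise Q x s' y =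
      (Pi.single x (M.tdMean Q x) : S × A → ℝ) y - M.lawInf y * M.tdMean Q y := by
    intro x
    simp only [noise_apply, mul_sub, Finset.sum_sub_distrib, ← Finset.sum_mul, M.trans_sum, one_mul]
    congr 1
    by_cases hxy : y = x
    · subst hxy; simp [tdMean]
    · simp [hxy]
  simp only [h, mul_sub, Finset.sum_sub_distrib, ← Finset.sum_mul, hM.sum_lawInf, one_mul]
  rw [Finset.sum_eq_single y (fun x _ hx => by simp [Ne.symm hx]) (by simp), Pi.single_eq_same,
    sub_self]

lemma IsErgodic.four_mul_horizon_le (hM : M.IsErgodic) : 4 * M.horizon ≤ M.errBound := by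
  have := M.one_le_horizon
  rw [errBound, le_div_iff₀ hM.rate_pos]
  nlinarith [hM.rate_le_one]

/-- `errBound` is where the contraction `α δ ‖e‖` balances the noise `α · 4 h`, so the ball of this
radius is preserved; it also contains the initial error. -/
lemma IsErgodic.norm_lower_sub_le (hM : M.IsErgodic) (hθ : 0 < θ) (hξ : θ ≤ ξ)
    (x : ℕ → S × A) (k : ℕ) : ‖M.lower θ ξ x k - M.Qstar‖ ≤ M.errBound := by
  have hh := M.one_le_horizon
  have hE := hM.four_mul_horizon_le
  induction k with
  | zero =>
    refine (pi_norm_le_iff_of_nonneg (by linarith)).2 fun y => ?_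
    refine (abs_sub (M.QL₀ y) (M.Qstar y)).trans ?_
    linarith [M.QL₀_bound y, abs_Qstar_le (M := M) y]
  | succ k ih =>
    rw [lower_succ_sub]
    have ha := stepSize_nonneg (ξ := ξ) hθ.le (hθ.le.trans hξ) k
    have ha1 := stepSize_le_one hθ hξ k
    set α := stepSize θ ξ k
    set e := M.lower θ ξ x k - M.Qstar
    have h1 := hM.norm_add_smul_T_le ha ha1 e
    have h2 : ‖M.noise (M.iterate θ ξ x k) (x k) (x (k + 1)).1‖ ≤ 4 * M.horizon :=
      (norm_le_l2norm _).trans (hM.l2norm_noise_le (norm_iterate_le hθ hξ x k) _ _)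
    refine (norm_add_le _ _).trans ?_
    rw [norm_smul, Real.norm_of_nonneg ha]
    have h3 := mul_le_mul_of_nonneg_left h2 ha
    have hδ := hM.rate_pos
    have hδ1 := hM.rate_le_one
    have h4 : (1 - α * ((1 - M.γ) * M.dmin)) * ‖e‖ ≤
        (1 - α * ((1 - M.γ) * M.dmin)) * M.errBound :=
      mul_le_mul_of_nonneg_left ih (by nlinarith)
    have h5 : (1 - M.γ) * M.dmin * M.errBound = 4 * M.horizon := by
      rw [errBound, mul_div_cancel₀ _ hδ.ne']
    have h6 : α * (4 * M.horizon) = α * ((1 - M.γ) * M.dmin) * M.errBound := by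
      rw [← h5]; ring
    linarith

lemma IsErgodic.l2norm_lower_sub_le (hM : M.IsErgodic) (hθ : 0 < θ) (hξ : θ ≤ ξ)
    (x : ℕ → S × A) (k : ℕ) :
    l2norm (M.lower θ ξ x k - M.Qstar) ≤ √M.size * M.errBound := by
  rw [size_eq_card]
  exact (l2norm_le _).trans
    (mul_le_mul_of_nonneg_left (hM.norm_lower_sub_le hθ hξ x k) (Real.sqrt_nonneg _))

lemma IsErgodic.l2norm_T_lower_sub_le (hM : M.IsErgodic) (hθ : 0 < θ) (hξ : θ ≤ ξ)
    (x : ℕ → S × A) (k : ℕ) :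
    l2norm (M.T *ᵥ (M.lower θ ξ x k - M.Qstar)) ≤ 2 * (√M.size * M.errBound) := by
  refine (l2norm_le _).trans ?_
  rw [← size_eq_card (M := M)]
  have h := hM.norm_T_mulVec_le (M.lower θ ξ x k - M.Qstar)
  have h1 := hM.norm_lower_sub_le hθ hξ x k
  have h2 : 2 * M.dmax * ‖M.lower θ ξ x k - M.Qstar‖ ≤ 2 * 1 * M.errBound := by
    have := hM.dmax_le_one
    gcongr
  calc _ ≤ √M.size * (2 * 1 * M.errBound) :=
        mul_le_mul_of_nonneg_left (h.trans h2) (Real.sqrt_nonneg _)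
    _ = _ := by ring

lemma IsErgodic.errBound_le (hM : M.IsErgodic) : M.errBound ≤ √M.size * M.errBound := by
  have := hM.four_mul_horizon_le
  have := M.one_le_horizon
  exact le_mul_of_one_le_left (by linarith) (Real.one_le_sqrt.2 one_le_size)

lemma IsErgodic.l2norm_lower_succ_sub_le (hM : M.IsErgodic) (hθ : 0 < θ) (hξ : θ ≤ ξ)
    (x : ℕ → S × A) (k : ℕ) :
    l2norm (M.lower θ ξ x (k + 1) - M.lower θ ξ x k) ≤
      stepSize θ ξ k * (3 * (√M.size * M.errBound)) := by
  have ha := stepSize_nonneg (ξ := ξ) hθ.le (hθ.le.trans hξ) k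
  have e : M.lower θ ξ x (k + 1) - M.lower θ ξ x k =
      stepSize θ ξ k • (M.T *ᵥ (M.lower θ ξ x k - M.Qstar)
        + M.noise (M.iterate θ ξ x k) (x k) (x (k + 1)).1) := by
    rw [← sub_sub_sub_cancel_right _ _ M.Qstar, lower_succ_sub, smul_add]; abel
  have hs : ∀ (a : ℝ) (v : S × A → ℝ), 0 ≤ a → l2norm (a • v) = a * l2norm v := fun a v h => by
    rw [l2norm, WithLp.toLp_smul, norm_smul, Real.norm_of_nonneg h, l2norm]
  rw [e, hs _ _ ha]
  refine mul_le_mul_of_nonneg_left ?_ ha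
  refine (l2norm_add_le _ _).trans ?_
  linarith [hM.l2norm_T_lower_sub_le hθ hξ x k, hM.errBound_le, hM.four_mul_horizon_le,
    hM.l2norm_noise_le (norm_iterate_le hθ hξ x k) (x k) (x (k + 1)).1]

end Ergodic

end IterateBounds

end QModel

/-! ### One-step drift of the Lyapunov function -/

namespace QModel

section Drift

variable {S A : Type*} [Fintype S] [Fintype A] [DecidableEq S] [DecidableEq A] {M : QModel S A}
  {G : Matrix (S × A) (S × A) ℝ} {c θ ξ : ℝ}

/-- The error of the lower comparison system. -/
noncomputable def err (M : QModel S A) (θ ξ : ℝ) (x : ℕ → S × A) (k : ℕ) : S × A → ℝ :=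
  M.lower θ ξ x k - M.Qstar

/-- The noise at time `k`. -/
noncomputable def noiseAt (M : QModel S A) (θ ξ : ℝ) (x : ℕ → S × A) (k : ℕ) : S × A → ℝ :=
  M.noise (M.iterate θ ξ x k) (x k) (x (k + 1)).1

/-- The scale of the cross terms of the drift. -/
noncomputable def crossBound (M : QModel S A) (G : Matrix (S × A) (S × A) ℝ) : ℝ :=
  M.horizon * specNorm G * (√M.size * M.errBound)

lemma IsLyapunov.lyapV_z (hG : M.IsLyapunov G) (θ ξ : ℝ) (x : ℕ → S × A) (k : ℕ) :
    lyapV (M.z G θ ξ x k) = M.err θ ξ x k ⬝ᵥ G *ᵥ M.err θ ξ x k := by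
  rw [lyapV, z, ← l2norm_sq, l2norm_sqrt_mulVec_sq hG.posDef.posSemidef, err]

lemma IsLyapunov.dotProduct_mulVec_comm (hG : M.IsLyapunov G) (v w : S × A → ℝ) :
    v ⬝ᵥ G *ᵥ w = w ⬝ᵥ G *ᵥ v := by
  have h := hG.posDef.isHermitian
  rw [Matrix.IsHermitian, Matrix.conjTranspose_eq_transpose_of_trivial] at h
  rw [Matrix.dotProduct_mulVec v, ← Matrix.mulVec_transpose, h, dotProduct_comm]

/-- The Lyapunov equation replaces the first-order term `2 a eᵀ G T e` by `-a ‖e‖²`. -/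
lemma IsLyapunov.quadratic_step (hG : M.IsLyapunov G) (a : ℝ) (e w : S × A → ℝ) :
    (e + a • M.T *ᵥ e + a • w) ⬝ᵥ G *ᵥ (e + a • M.T *ᵥ e + a • w) =
      e ⬝ᵥ G *ᵥ e - a * l2norm e ^ 2 + a ^ 2 * ((M.T *ᵥ e) ⬝ᵥ G *ᵥ (M.T *ᵥ e))
        + 2 * a * (w ⬝ᵥ G *ᵥ e) + 2 * a ^ 2 * (w ⬝ᵥ G *ᵥ (M.T *ᵥ e)) + a ^ 2 * (w ⬝ᵥ G *ᵥ w) := by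
  have h := hG.dotProduct_equation e
  simp only [Matrix.mulVec_add, Matrix.mulVec_smul, add_dotProduct, dotProduct_add,
    smul_dotProduct, dotProduct_smul, smul_eq_mul, hG.dotProduct_mulVec_comm e w,
    hG.dotProduct_mulVec_comm (M.T *ᵥ e) w, hG.dotProduct_mulVec_comm (M.T *ᵥ e) e]
  have h' : l2norm e ^ 2 = -(2 * (e ⬝ᵥ G *ᵥ (M.T *ᵥ e))) := by linarith
  rw [h']
  ring

lemma IsAdmissible.ξ_pos (h : M.IsAdmissible G c θ ξ) : 0 < ξ := h.θ_pos.trans_le h.θ_le_ξ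

lemma IsAdmissible.stepSize_le (h : M.IsAdmissible G c θ ξ) (k : ℕ) :
    stepSize θ ξ k ≤ stepSize θ ξ 0 := by
  have := h.ξ_pos
  have := h.θ_pos
  rw [stepSize, stepSize]
  gcongr
  simp

lemma IsAdmissible.stepSize_pos (h : M.IsAdmissible G c θ ξ) (k : ℕ) : 0 < stepSize θ ξ k := by
  have := h.ξ_pos
  exact div_pos h.θ_pos (by positivity)

/-- Since `V ≤ ‖G‖ ‖e‖²` and `α_k ≤ α_0`, admissibility gives `(η + α_k ‖B‖²) V ≤ ‖e‖²`. The `B`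
part cancels the second-order term, and `η α_k ≥ 2/(k+ξ)`. -/
lemma IsAdmissible.contraction_le (h : M.IsAdmissible G c θ ξ) (hG : M.IsLyapunov G)
    (k : ℕ) (e : S × A → ℝ) :
    e ⬝ᵥ G *ᵥ e - stepSize θ ξ k * l2norm e ^ 2
        + stepSize θ ξ k ^ 2 * ((M.T *ᵥ e) ⬝ᵥ G *ᵥ (M.T *ᵥ e)) ≤
      (1 - 2 / (k + ξ)) * (e ⬝ᵥ G *ᵥ e) := by
  obtain ⟨η, h1, h2⟩ := h.contraction
  have hξ := h.ξ_pos
  have ha := h.stepSize_pos k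
  have ha0 := h.stepSize_le k
  have hV := hG.dotProduct_mulVec_nonneg e
  have hB := hG.dotProduct_T_le_B e
  have hl : e ⬝ᵥ G *ᵥ e ≤ specNorm G * l2norm e ^ 2 := by
    refine (le_abs_self _).trans ((abs_dotProduct_mulVec_le G e e).trans (le_of_eq ?_)); ring
  have hη : 2 / (k + ξ) ≤ η * stepSize θ ξ k := by
    rw [stepSize, mul_div_assoc']
    gcongr
  set α := stepSize θ ξ k
  set V := e ⬝ᵥ G *ᵥ e
  set b := specNorm (M.B G)
  set l := specNorm G
  have hl0 : 0 ≤ l := specNorm_nonneg G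
  set N := l2norm e ^ 2
  have hN : 0 ≤ N := sq_nonneg _
  have hη0 : 0 ≤ η := by
    by_contra hneg
    nlinarith [h.θ_pos]
  have hsum : (η + α * b ^ 2) * l ≤ 1 :=
    (mul_le_mul_of_nonneg_right (by gcongr) hl0).trans h2
  have hkey : (η + α * b ^ 2) * V ≤ N := by
    calc (η + α * b ^ 2) * V ≤ (η + α * b ^ 2) * (l * N) := by gcongr
      _ = (η + α * b ^ 2) * l * N := by ring
      _ ≤ 1 * N := by gcongr
      _ = N := one_mul N
  have h3 := mul_le_mul_of_nonneg_left hkey ha.le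
  have h4 := mul_le_mul_of_nonneg_right hη hV
  have h5 := mul_le_mul_of_nonneg_left hB (sq_nonneg α)
  nlinarith

lemma crossBound_nonneg (hE : 0 ≤ M.errBound) : 0 ≤ M.crossBound G := by
  have := M.one_le_horizon
  have := specNorm_nonneg G
  rw [crossBound]
  positivity

lemma abs_dotProduct_le_crossBound {w e : S × A → ℝ} {a b : ℝ}
    (ha : 0 ≤ a) (hw : l2norm w ≤ a * M.horizon) (he : l2norm e ≤ b * (√M.size * M.errBound)) :
    |w ⬝ᵥ G *ᵥ e| ≤ a * b * M.crossBound G := by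
  have := M.one_le_horizon
  refine (abs_dotProduct_mulVec_le G w e).trans ?_
  calc l2norm w * (specNorm G * l2norm e)
      ≤ (a * M.horizon) * (specNorm G * (b * (√M.size * M.errBound))) := by
        have := specNorm_nonneg G
        have := l2norm_nonneg e
        gcongr
    _ = _ := by rw [crossBound]; ring

variable [Nonempty S] [Nonempty A]

lemma IsErgodic.errBound_nonneg (hM : M.IsErgodic) : 0 ≤ M.errBound := by
  linarith [hM.four_mul_horizon_le, M.one_le_horizon]

lemma IsErgodic.l2norm_err_le (hM : M.IsErgodic) (h : M.IsAdmissible G c θ ξ) (x : ℕ → S × A)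
    (k : ℕ) : l2norm (M.err θ ξ x k) ≤ 1 * (√M.size * M.errBound) := by
  rw [one_mul]; exact hM.l2norm_lower_sub_le h.θ_pos h.θ_le_ξ x k

lemma IsErgodic.l2norm_noiseAt_le (hM : M.IsErgodic) (h : M.IsAdmissible G c θ ξ)
    (x : ℕ → S × A) (k : ℕ) : l2norm (M.noiseAt θ ξ x k) ≤ 4 * M.horizon :=
  hM.l2norm_noise_le (norm_iterate_le h.θ_pos h.θ_le_ξ x k) _ _

lemma IsErgodic.abs_cross_le (hM : M.IsErgodic) (h : M.IsAdmissible G c θ ξ) (x : ℕ → S × A)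
    (k : ℕ) : |M.noiseAt θ ξ x k ⬝ᵥ G *ᵥ M.err θ ξ x k| ≤ 4 * M.crossBound G := by
  simpa using abs_dotProduct_le_crossBound (G := G) (by norm_num) (hM.l2norm_noiseAt_le h x k)
    (hM.l2norm_err_le h x k)

/-- One step of the drift inequality, along a path. -/
lemma IsErgodic.drift_step (hM : M.IsErgodic) (hG : M.IsLyapunov G) (h : M.IsAdmissible G c θ ξ)
    (x : ℕ → S × A) (k : ℕ) :
    lyapV (M.z G θ ξ x (k + 1)) ≤ (1 - 2 / (k + ξ)) * lyapV (M.z G θ ξ x k)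
      + 2 * stepSize θ ξ k * (M.noiseAt θ ξ x k ⬝ᵥ G *ᵥ M.err θ ξ x k)
      + 20 * M.crossBound G * stepSize θ ξ k ^ 2 := by
  rw [hG.lyapV_z, hG.lyapV_z]
  have e : M.err θ ξ x (k + 1) = M.err θ ξ x k + stepSize θ ξ k • M.T *ᵥ M.err θ ξ x k
      + stepSize θ ξ k • M.noiseAt θ ξ x k := lower_succ_sub θ ξ x k
  rw [e, hG.quadratic_step]
  have h1 := h.contraction_le hG k (M.err θ ξ x k)
  have hw := hM.l2norm_noiseAt_le h x k
  have hw' : l2norm (M.noiseAt θ ξ x k) ≤ 1 * (√M.size * M.errBound) := by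
    linarith [hM.four_mul_horizon_le, hM.errBound_le]
  -- The two noise terms of order `α²` contribute `2 · (4 · 2) + 4 = 20` times `crossBound`.
  have h2 := abs_dotProduct_le_crossBound (G := G) (by norm_num) hw
    (hM.l2norm_T_lower_sub_le h.θ_pos h.θ_le_ξ x k)
  have h3 := abs_dotProduct_le_crossBound (G := G) (by norm_num) hw hw'
  have h4 := mul_le_mul_of_nonneg_left ((le_abs_self _).trans h2) (sq_nonneg (stepSize θ ξ k))
  have h5 := mul_le_mul_of_nonneg_left ((le_abs_self _).trans h3) (sq_nonneg (stepSize θ ξ k))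
  rw [err] at *
  linarith

/-- The cross term changes little when the iterates are frozen `τ` steps before. -/
lemma IsErgodic.cross_sub_le (hM : M.IsErgodic) (h : M.IsAdmissible G c θ ξ) (x : ℕ → S × A)
    {j τ : ℕ} (hj : τ ≤ j) :
    |M.noiseAt θ ξ x (j + τ) ⬝ᵥ G *ᵥ M.err θ ξ x (j + τ) -
      M.noise (M.iterate θ ξ x j) (x (j + τ)) (x (j + τ + 1)).1 ⬝ᵥ G *ᵥ M.err θ ξ x j| ≤
      40 * M.crossBound G * τ * stepSize θ ξ (j + τ) := by
  have hξ := h.ξ_pos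
  have hθ := h.θ_pos
  set α := stepSize θ ξ (j + τ) with hα
  have hα0 : 0 < α := h.stepSize_pos _
  -- As `τ ≤ j`, no step-size after time `j` exceeds twice the current one.
  have hstep : ∀ i, stepSize θ ξ (j + i) ≤ 2 * α := fun i => by
    have h1 : (τ : ℝ) ≤ j := by exact_mod_cast hj
    rw [hα, stepSize, stepSize, mul_div_assoc', div_le_div_iff₀ (by positivity) (by positivity)]
    push_cast
    have : (j : ℝ) + τ + ξ ≤ 2 * (j + i + ξ) := by
      have : (0 : ℝ) ≤ i := Nat.cast_nonneg i
      linarith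
    nlinarith
  have hh := M.one_le_horizon
  have hE := hM.errBound_nonneg
  have hQ : ∀ i, ‖M.iterate θ ξ x (j + i) - M.iterate θ ξ x j‖ ≤ i * α * (4 * M.horizon) := by
    intro i
    induction i with
    | zero => simp
    | succ i ih =>
      have h1 := norm_iterate_succ_sub_le (M := M) h.θ_pos h.θ_le_ξ x (j + i)
      have h2 := norm_add_le (M.iterate θ ξ x (j + i + 1) - M.iterate θ ξ x (j + i))
        (M.iterate θ ξ x (j + i) - M.iterate θ ξ x j)
      rw [sub_add_sub_cancel] at h2
      have h3 := mul_le_mul_of_nonneg_right (hstep i) (by linarith : 0 ≤ 2 * M.horizon)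
      rw [← add_assoc]
      push_cast
      linarith
  have hL : ∀ i, l2norm (M.lower θ ξ x (j + i) - M.lower θ ξ x j) ≤
      i * α * (6 * (√M.size * M.errBound)) := by
    intro i
    induction i with
    | zero => simp [l2norm]
    | succ i ih =>
      have h1 := hM.l2norm_lower_succ_sub_le h.θ_pos h.θ_le_ξ x (j + i)
      have h2 := l2norm_add_le (M.lower θ ξ x (j + i + 1) - M.lower θ ξ x (j + i))
        (M.lower θ ξ x (j + i) - M.lower θ ξ x j)
      rw [sub_add_sub_cancel] at h2
      have h3 := mul_le_mul_of_nonneg_right (hstep i)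
        (by positivity : 0 ≤ 3 * (√M.size * M.errBound))
      rw [← add_assoc]
      push_cast
      linarith
  set w := M.noiseAt θ ξ x (j + τ)
  set w' := M.noise (M.iterate θ ξ x j) (x (j + τ)) (x (j + τ + 1)).1
  have e : w ⬝ᵥ G *ᵥ M.err θ ξ x (j + τ) - w' ⬝ᵥ G *ᵥ M.err θ ξ x j =
      (w - w') ⬝ᵥ G *ᵥ M.err θ ξ x (j + τ)
        + w' ⬝ᵥ G *ᵥ (M.err θ ξ x (j + τ) - M.err θ ξ x j) := by
    rw [Matrix.mulVec_sub, dotProduct_sub, sub_dotProduct]; ring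
  have hww : l2norm (w - w') ≤ (16 * τ * α) * M.horizon := by
    refine (hM.l2norm_noise_sub_le _ _ _ _).trans ?_
    linarith [hQ τ]
  have hee : l2norm (M.err θ ξ x (j + τ) - M.err θ ξ x j) ≤
      (6 * τ * α) * (√M.size * M.errBound) := by
    rw [err, err, sub_sub_sub_cancel_right]
    linarith [hL τ]
  -- The change of the noise costs `16 τ α` and that of the error `4 · 6 τ α`, whence 40.
  have h1 := abs_dotProduct_le_crossBound (G := G) (by positivity) hww
    (hM.l2norm_err_le h x (j + τ))
  have h2 := abs_dotProduct_le_crossBound (G := G) (by norm_num)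
    (hM.l2norm_noise_le (norm_iterate_le h.θ_pos h.θ_le_ξ x j) (x (j + τ)) (x (j + τ + 1)).1) hee
  rw [e]
  refine (abs_add_le _ _).trans ?_
  linarith

end Drift

end QModel

/-! ### Expectations along trajectories and the Markov property -/

namespace QModel

section Trajectories

variable {S A : Type*} [Fintype S] [Fintype A] {M : QModel S A}

/-- Extension of a finite path by its last entry. -/
def extendPath {α : Type*} {n : ℕ} (p : Fin (n + 1) → α) (i : ℕ) : α := p ⟨min i n, by omega⟩

lemma extendPath_of_le {α : Type*} {n i : ℕ} (p : Fin (n + 1) → α) (h : i ≤ n) :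
    extendPath p i = p ⟨i, by omega⟩ := by
  simp [extendPath, h]

lemma extendPath_snoc_of_le {α : Type*} {n i : ℕ} (p : Fin (n + 1) → α) (y : α) (h : i ≤ n) :
    extendPath (Fin.snoc p y : Fin (n + 2) → α) i = extendPath p i := by
  rw [extendPath_of_le _ h, extendPath_of_le _ (by omega)]
  simp [Fin.snoc, Nat.lt_succ_of_le h, Fin.castLT]

lemma extendPath_snoc_last {α : Type*} {n : ℕ} (p : Fin (n + 1) → α) (y : α) :
    extendPath (Fin.snoc p y : Fin (n + 2) → α) (n + 1) = y := by
  rw [extendPath_of_le _ le_rfl]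
  simp [Fin.snoc]

/-- The probability of the path `x 0, …, x n`. -/
def pathWeight (M : QModel S A) (n : ℕ) (x : ℕ → S × A) : ℝ :=
  M.init (x 0) * ∏ i ∈ Finset.range n, M.chain (x i) (x (i + 1))

lemma pathWeight_congr {n : ℕ} {x y : ℕ → S × A} (h : ∀ i ≤ n, x i = y i) :
    M.pathWeight n x = M.pathWeight n y := by
  rw [pathWeight, pathWeight, h 0 (Nat.zero_le n)]
  congr 1
  refine Finset.prod_congr rfl fun i hi => ?_
  have := Finset.mem_range.1 hi
  rw [h i (by omega), h (i + 1) (by omega)]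

lemma pathWeight_succ (n : ℕ) (x : ℕ → S × A) :
    M.pathWeight (n + 1) x = M.pathWeight n x * M.chain (x n) (x (n + 1)) := by
  rw [pathWeight, pathWeight, Finset.prod_range_succ, mul_assoc]

namespace IsTrajectory

variable {Ω : Type*} [MeasurableSpace Ω] {μ : Measure Ω} [IsProbabilityMeasure μ]
  {X : ℕ → Ω → S × A}

/-- Such an `F` factors through the finite set of paths of length `n`, so its expectation is a
finite sum of path weights. -/
lemma integrable_and_integral (hX : M.IsTrajectory μ X) {n : ℕ} {F : (ℕ → S × A) → ℝ}
    (hF : ∀ x y : ℕ → S × A, (∀ i ≤ n, x i = y i) → F x = F y) :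
    Integrable (fun ω => F fun i => X i ω) μ ∧ ∫ ω, F (fun i => X i ω) ∂μ =
      ∑ p : Fin (n + 1) → S × A, M.pathWeight n (extendPath p) * F (extendPath p) := by
  let : MeasurableSpace (Fin (n + 1) → S × A) := ⊤
  let path : Ω → Fin (n + 1) → S × A := fun ω i => X i ω
  have hset : ∀ p, path ⁻¹' {p} = {ω | ∀ i ≤ n, X i ω = extendPath p i} := by
    intro p
    ext ω
    simp only [Set.mem_preimage, Set.mem_singleton_iff, Set.mem_ofPred_eq]
    constructor
    · rintro rfl i hi
      rw [extendPath_of_le _ hi]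
    · intro h
      funext i
      have := h i (by omega)
      rwa [extendPath_of_le _ (by omega)] at this
  have hmeas : Measurable path := by
    refine measurable_to_countable' fun p => ?_
    have : path ⁻¹' {p} = ⋂ i : Fin (n + 1), {ω | X i ω = p i} := by
      ext ω
      simp [path, funext_iff]
    rw [this]
    exact MeasurableSet.iInter fun i => hX.measurable i (p i)
  have hcomp : (fun ω => F fun i => X i ω) = fun ω => F (extendPath (path ω)) := by
    funext ω
    refine hF _ _ fun i hi => ?_
    rw [extendPath_of_le _ hi]
  have hmap : IsProbabilityMeasure (μ.map path) := Measure.isProbabilityMeasure_map hmeas.aemeasurable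
  have hint : Integrable (fun p => F (extendPath p)) (μ.map path) := Integrable.of_finite
  rw [hcomp]
  refine ⟨hint.comp_measurable hmeas, ?_⟩
  rw [← integral_map (f := fun p => F (extendPath p)) hmeas.aemeasurable
    hint.aestronglyMeasurable, integral_fintype hint]
  refine Finset.sum_congr rfl fun p _ => ?_
  rw [map_measureReal_apply hmeas (MeasurableSet.singleton p), hset, hX.path_law, smul_eq_mul,
    pathWeight]

lemma integrable (hX : M.IsTrajectory μ X) {n : ℕ} {F : (ℕ → S × A) → ℝ}
    (hF : ∀ x y : ℕ → S × A, (∀ i ≤ n, x i = y i) → F x = F y) :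
    Integrable (fun ω => F fun i => X i ω) μ := (hX.integrable_and_integral hF).1

/-- The Markov property, for one step. -/
lemma integral_succ (hX : M.IsTrajectory μ X) {n : ℕ} {Φ : (ℕ → S × A) → S × A → ℝ}
    (hΦ : ∀ x y : ℕ → S × A, (∀ i ≤ n, x i = y i) → Φ x = Φ y) :
    ∫ ω, Φ (fun i => X i ω) (X (n + 1) ω) ∂μ =
      ∫ ω, ∑ y, M.chain (X n ω) y * Φ (fun i => X i ω) y ∂μ := by
  rw [(hX.integrable_and_integral (n := n + 1) (F := fun x => Φ x (x (n + 1))) fun x y h => by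
    simp only [hΦ x y fun i hi => h i (by omega), h (n + 1) le_rfl]).2]
  rw [(hX.integrable_and_integral (n := n) (F := fun x => ∑ y, M.chain (x n) y * Φ x y)
    fun x y h => by simp only [hΦ x y h, h n le_rfl]).2]
  rw [← (Fin.snocEquiv fun _ : Fin (n + 2) => S × A).sum_comp, Fintype.sum_prod_type_right]
  refine Finset.sum_congr rfl fun p _ => ?_
  rw [Finset.mul_sum]
  refine Finset.sum_congr rfl fun y _ => ?_
  have h : ∀ i ≤ n, extendPath (Fin.snoc p y : Fin (n + 2) → S × A) i = extendPath p i :=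
    fun i hi => extendPath_snoc_of_le p y hi
  have e : (Fin.snocEquiv fun _ : Fin (n + 2) => S × A) (y, p) = (Fin.snoc p y : Fin (n + 2) → S × A) :=
    rfl
  rw [e, extendPath_snoc_last, pathWeight_succ, pathWeight_congr h, hΦ _ _ h, extendPath_snoc_last,
    h n le_rfl, mul_assoc]

variable [DecidableEq S] [DecidableEq A]

/-- The Markov property, for several steps. -/
lemma integral_add (hX : M.IsTrajectory μ X) {n : ℕ} (t : ℕ) {Φ : (ℕ → S × A) → S × A → ℝ}
    (hΦ : ∀ x y : ℕ → S × A, (∀ i ≤ n, x i = y i) → Φ x = Φ y) :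
    ∫ ω, Φ (fun i => X i ω) (X (n + t) ω) ∂μ =
      ∫ ω, ∑ y, (M.chain ^ t) (X n ω) y * Φ (fun i => X i ω) y ∂μ := by
  induction t generalizing Φ with
  | zero => simp [Matrix.one_apply]
  | succ t ih =>
    have h1 := hX.integral_succ (n := n + t) (Φ := Φ) fun x y h => hΦ x y fun i hi => h i (by omega)
    have h2 := ih (Φ := fun x a => ∑ y, M.chain a y * Φ x y) fun x y h => by rw [hΦ x y h]
    rw [← add_assoc, h1, h2]
    congr 1
    funext ω
    simp only [pow_succ, Matrix.mul_apply, Finset.mul_sum, Finset.sum_mul]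
    rw [Finset.sum_comm]
    simp only [mul_assoc]

end IsTrajectory

end Trajectories

/-! ### Expectation of the frozen cross term -/

section MarkovNoise

variable {S A : Type*} [Fintype S] [Fintype A] [DecidableEq S] [DecidableEq A] {M : QModel S A}
  {G : Matrix (S × A) (S × A) ℝ} {c θ ξ m ρ : ℝ}

omit [DecidableEq S] [DecidableEq A] in
lemma sum_chain_mul (a : S × A) (f : S → ℝ) :
    ∑ y, M.chain a y * f y.1 = ∑ s', M.trans a.1 a.2 s' * f s' := by
  simp only [chain, Matrix.of_apply, Fintype.sum_prod_type]
  refine Finset.sum_congr rfl fun s _ => ?_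
  simp only [mul_right_comm _ (M.behavior _ _), ← Finset.mul_sum, M.behavior_sum, mul_one]

variable [Nonempty S] [Nonempty A]

lemma IsErgodic.sum_lawInf_mul_cross (hM : M.IsErgodic) (Q v : S × A → ℝ) :
    ∑ a, M.lawInf a * ∑ y, M.chain a y * (M.noise Q a y.1 ⬝ᵥ v) = 0 := by
  have h : ∀ a, ∑ y, M.chain a y * (M.noise Q a y.1 ⬝ᵥ v) =
      ∑ z, (∑ s', M.trans a.1 a.2 s' * M.noise Q a s' z) * v z := by
    intro a
    rw [sum_chain_mul a fun s => M.noise Q a s ⬝ᵥ v]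
    simp only [dotProduct, Finset.mul_sum, Finset.sum_mul, mul_assoc]
    exact Finset.sum_comm
  have hswap : ∀ N : S × A → S × A → ℝ, ∑ a, M.lawInf a * ∑ z, N a z * v z =
      ∑ z, (∑ a, M.lawInf a * N a z) * v z := by
    intro N
    simp only [Finset.mul_sum, Finset.sum_mul, mul_assoc]
    exact Finset.sum_comm
  simp only [h, hswap fun a z => ∑ s', M.trans a.1 a.2 s' * M.noise Q a s' z,
    hM.sum_lawInf_mul_noise, zero_mul, Finset.sum_const_zero]

/-- After the mixing time, the noise of a frozen iterate is nearly centred. -/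
lemma IsErgodic.integral_frozen_cross_le (hM : M.IsErgodic) (h : M.IsAdmissible G c θ ξ)
    (hmix : M.IsMixing m ρ) {Ω : Type*} [MeasurableSpace Ω] {μ : Measure Ω}
    [IsProbabilityMeasure μ] {X : ℕ → Ω → S × A} (hX : M.IsTrajectory μ X) (j t : ℕ) :
    ∫ ω, M.noise (M.iterate θ ξ (fun i => X i ω) j) (X (j + t) ω) (X (j + t + 1) ω).1 ⬝ᵥ
      G *ᵥ M.err θ ξ (fun i => X i ω) j ∂μ ≤ 8 * M.crossBound G * (m * ρ ^ t) := by
  have hE : ∀ x y : ℕ → S × A, (∀ i ≤ j, x i = y i) → M.err θ ξ x j = M.err θ ξ y j :=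
    fun x y hxy => by rw [err, err, lower_congr θ ξ hxy]
  have h1 := hX.integral_succ (n := j + t)
    (Φ := fun x y => M.noise (M.iterate θ ξ x j) (x (j + t)) y.1 ⬝ᵥ G *ᵥ M.err θ ξ x j)
    fun x y hxy => by
      have hj : ∀ i ≤ j, x i = y i := fun i hi => hxy i (by omega)
      rw [iterate_congr θ ξ hj, hE x y hj, hxy (j + t) le_rfl]
  -- `Ψ x a` is the conditional expectation of the frozen cross term given the path up to `j` and
  -- the pair `a` at time `j + t`.
  set Ψ : (ℕ → S × A) → S × A → ℝ := fun x a =>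
    ∑ y, M.chain a y * (M.noise (M.iterate θ ξ x j) a y.1 ⬝ᵥ G *ᵥ M.err θ ξ x j) with hΨ
  have hΨc : ∀ x y : ℕ → S × A, (∀ i ≤ j, x i = y i) → Ψ x = Ψ y := fun x y hxy => by
    rw [hΨ]; simp only [iterate_congr θ ξ hxy, hE x y hxy]
  have h2 := hX.integral_add t hΨc
  have hbound : ∀ x a, |Ψ x a| ≤ 4 * M.crossBound G := by
    intro x a
    rw [hΨ]
    simp only
    rw [sum_chain_mul a fun s => M.noise (M.iterate θ ξ x j) a s ⬝ᵥ G *ᵥ M.err θ ξ x j]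
    refine abs_sum_trans_mul_le a fun s => ?_
    simpa using abs_dotProduct_le_crossBound (G := G) (by norm_num)
      (hM.l2norm_noise_le (norm_iterate_le h.θ_pos h.θ_le_ξ x j) a s) (hM.l2norm_err_le h x j)
  have hpt : ∀ x : ℕ → S × A, ∑ a, (M.chain ^ t) (x j) a * Ψ x a ≤
      8 * M.crossBound G * (m * ρ ^ t) := by
    intro x
    -- The stationary average vanishes, so only the deviation of the `t`-step law from `μ_∞` counts;
    -- its `ℓ¹` norm is at most twice the total variation.
    have hz : ∑ a, M.lawInf a * Ψ x a = 0 := hM.sum_lawInf_mul_cross _ _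
    have htv := (sum_abs_sub_le_two_mul_tvDist ((M.chain ^ t) (x j)) M.lawInf).trans
      (mul_le_mul_of_nonneg_left (hmix.dist_le (x j) t) (by norm_num))
    have hc : 0 ≤ M.crossBound G := crossBound_nonneg hM.errBound_nonneg
    calc ∑ a, (M.chain ^ t) (x j) a * Ψ x a
        = ∑ a, ((M.chain ^ t) (x j) a - M.lawInf a) * Ψ x a := by
          simp only [sub_mul, Finset.sum_sub_distrib, hz, sub_zero]
      _ ≤ ∑ a, |(M.chain ^ t) (x j) a - M.lawInf a| * (4 * M.crossBound G) :=
          Finset.sum_le_sum fun a _ => by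
            refine (le_abs_self _).trans ?_
            rw [abs_mul]
            exact mul_le_mul_of_nonneg_left (hbound x a) (abs_nonneg _)
      _ ≤ 2 * (m * ρ ^ t) * (4 * M.crossBound G) := by
          rw [← Finset.sum_mul]
          gcongr
      _ = _ := by ring
  rw [h1]
  refine le_of_eq_of_le h2 ?_
  refine (integral_mono (hX.integrable (n := j) (F := fun x => ∑ a, (M.chain ^ t) (x j) a * Ψ x a)
    fun x y hxy => by simp only [hΨc x y hxy, hxy j le_rfl]) (integrable_const _)
    fun ω => hpt fun i => X i ω).trans ?_
  simp

end MarkovNoise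

end QModel

/-! ### Mixing times and summation of the recursion -/

section MixingTime

variable {m ρ θ ξ : ℝ}

lemma mixTime_spec (hρ0 : 0 < ρ) (hρ1 : ρ < 1) {c : ℝ} (hc : 0 < c) :
    m * ρ ^ mixTime m ρ c ≤ c := by
  have hlim : Tendsto (fun k : ℕ => m * ρ ^ k) atTop (𝓝 0) := by
    simpa using (tendsto_pow_atTop_nhds_zero_of_lt_one hρ0.le hρ1).const_mul m
  obtain ⟨k, hk⟩ := (hlim.eventually_le_const hc).exists
  exact Nat.sInf_mem (s := {k : ℕ | m * ρ ^ k ≤ c}) ⟨k, hk⟩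

lemma mixTime_anti (hρ0 : 0 < ρ) (hρ1 : ρ < 1) {c c' : ℝ} (hc : 0 < c) (h : c ≤ c') :
    mixTime m ρ c' ≤ mixTime m ρ c :=
  Nat.sInf_le ((mixTime_spec hρ0 hρ1 hc).trans h)

lemma stepSize_anti (hθ : 0 ≤ θ) (hξ : 0 < ξ) {i k : ℕ} (h : i ≤ k) :
    stepSize θ ξ k ≤ stepSize θ ξ i := by
  rw [stepSize, stepSize]
  gcongr

/-- The infimum must be shown to be attained: with `j = ⌊t/2⌋`, `m ρ^j (t + ξ) → 0`, so eventually
`τ(α_t) ≤ t/2`. -/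
lemma mixStart_spec (hρ0 : 0 < ρ) (hρ1 : ρ < 1) (hθ : 0 < θ) (hξ : 0 < ξ) {t : ℕ}
    (ht : mixStart m ρ θ ξ ≤ t) : 2 * mixTime m ρ (stepSize θ ξ t) ≤ t := by
  have hlim : Tendsto (fun j : ℕ => m * (2 * (j * ρ ^ j) + (1 + ξ) * ρ ^ j)) atTop (𝓝 0) := by
    simpa using (((tendsto_self_mul_const_pow_of_lt_one hρ0.le hρ1).const_mul 2).add
      ((tendsto_pow_atTop_nhds_zero_of_lt_one hρ0.le hρ1).const_mul (1 + ξ))).const_mul m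
  obtain ⟨J, hJ⟩ := eventually_atTop.1 (hlim.eventually_le_const hθ)
  have hmem : mixStart m ρ θ ξ ∈
      {k : ℕ | ∀ t : ℕ, k ≤ t → 2 * mixTime m ρ (stepSize θ ξ t) ≤ t} := by
    refine Nat.sInf_mem ⟨2 * J, fun t ht => ?_⟩
    have hj := hJ (t / 2) (by omega)
    have hle : mixTime m ρ (stepSize θ ξ t) ≤ t / 2 := by
      refine Nat.sInf_le ?_
      have ht2 : (t : ℝ) ≤ 2 * (t / 2 : ℕ) + 1 := by exact_mod_cast (by omega : t ≤ 2 * (t / 2) + 1)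
      change m * ρ ^ (t / 2) ≤ θ / (t + ξ)
      rw [le_div_iff₀ (by positivity)]
      rcases le_or_gt m 0 with hm | hm
      · exact (mul_nonpos_of_nonpos_of_nonneg (mul_nonpos_of_nonpos_of_nonneg hm
          (by positivity)) (by positivity)).trans hθ.le
      · calc m * ρ ^ (t / 2) * (t + ξ) ≤ m * ρ ^ (t / 2) * (2 * (t / 2 : ℕ) + 1 + ξ) := by gcongr
          _ = m * (2 * ((t / 2 : ℕ) * ρ ^ (t / 2)) + (1 + ξ) * ρ ^ (t / 2)) := by ring
          _ ≤ θ := hj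
    omega
  exact hmem t ht

/-- By minimality the condition fails at `t = K_mix - 1`, so `K_mix ≤ 2 τ(α_t)`, and `τ(α_t) ≤
τ(α_k)` because the step-sizes decrease. -/
lemma mixStart_le (hρ0 : 0 < ρ) (hρ1 : ρ < 1) (hθ : 0 < θ) (hξ : 0 < ξ) {k : ℕ}
    (hk : mixStart m ρ θ ξ ≤ k) : mixStart m ρ θ ξ ≤ 2 * mixTime m ρ (stepSize θ ξ k) := by
  rcases Nat.eq_zero_or_pos (mixStart m ρ θ ξ) with h0 | hpos
  · omega
  have hnot := Nat.notMem_of_lt_sInf (s := {k : ℕ | ∀ t : ℕ, k ≤ t →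
    2 * mixTime m ρ (stepSize θ ξ t) ≤ t}) (m := mixStart m ρ θ ξ - 1)
    (by change _ < mixStart m ρ θ ξ; omega)
  have hex : ∃ t, mixStart m ρ θ ξ - 1 ≤ t ∧ t < 2 * mixTime m ρ (stepSize θ ξ t) := by
    by_contra hcon
    push Not at hcon
    exact hnot hcon
  obtain ⟨t, ht1, ht2⟩ := hex
  have ht3 : t < mixStart m ρ θ ξ := by
    by_contra hcon
    have := mixStart_spec hρ0 hρ1 hθ hξ (not_lt.1 hcon)
    omega
  have hα : 0 < stepSize θ ξ k := div_pos hθ (by positivity)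
  have := mixTime_anti (m := m) hρ0 hρ1 hα (stepSize_anti hθ.le hξ (show t ≤ k by omega))
  omega

end MixingTime

/-- The weight fits the rate 2: with `x = k + ξ`, `(x+1)² (1 - 2/x) = x² - 3 - 2/x ≤ x²`. The factor
4 comes from `x + 1 ≤ 2x`. -/
lemma weighted_sum_of_recursion {a b : ℕ → ℝ} {ξ : ℝ} (hξ : 1 ≤ ξ) (ha : ∀ k, 0 ≤ a k)
    (hb : ∀ k, 0 ≤ b k) (h : ∀ k : ℕ, a (k + 1) ≤ (1 - 2 / (k + ξ)) * a k + b k) (k : ℕ) :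
    (k + ξ) ^ 2 * a k ≤ ξ ^ 2 * a 0 + ∑ i ∈ Finset.range k, 4 * (i + ξ) ^ 2 * b i := by
  induction k with
  | zero => simp
  | succ k ih =>
    rw [Finset.sum_range_succ, ← add_assoc]
    refine le_trans ?_ (add_le_add_left ih _)
    have hx : 1 ≤ (k : ℝ) + ξ := by
      have : (0 : ℝ) ≤ k := Nat.cast_nonneg k
      linarith
    have hk := h k
    push_cast
    rw [show (k : ℝ) + 1 + ξ = k + ξ + 1 by ring]
    set x := (k : ℝ) + ξ
    have h1 : (x + 1) ^ 2 * (1 - 2 / x) ≤ x ^ 2 := by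
      have e : (x + 1) ^ 2 * (1 - 2 / x) = x ^ 2 - 3 - 2 / x := by
        field_simp; ring
      have : 0 ≤ 2 / x := by positivity
      linarith
    have h2 : (x + 1) ^ 2 ≤ 4 * x ^ 2 := by nlinarith
    calc (x + 1) ^ 2 * a (k + 1) ≤ (x + 1) ^ 2 * ((1 - 2 / x) * a k + b k) := by gcongr
      _ = (x + 1) ^ 2 * (1 - 2 / x) * a k + (x + 1) ^ 2 * b k := by ring
      _ ≤ x ^ 2 * a k + 4 * x ^ 2 * b k := by
        have := ha k
        have := hb k
        gcongr

/-! ### The mean square bound -/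

namespace QModel

section MeanSquare

variable {S A : Type*} [Fintype S] [Fintype A] [DecidableEq S] [DecidableEq A] {M : QModel S A}
  {G : Matrix (S × A) (S × A) ℝ} {c θ ξ m ρ : ℝ} {Ω : Type*} [MeasurableSpace Ω] {μ : Measure Ω}
  [IsProbabilityMeasure μ] {X : ℕ → Ω → S × A}

lemma IsTrajectory.integrable_lyapV (hX : M.IsTrajectory μ X) (G : Matrix (S × A) (S × A) ℝ)
    (θ ξ : ℝ) (k : ℕ) : Integrable (fun ω => lyapV (M.z G θ ξ (fun i => X i ω) k)) μ :=
  hX.integrable (n := k) (F := fun x => lyapV (M.z G θ ξ x k)) fun x y h => by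
    rw [z, z, lower_congr θ ξ h]

lemma noiseAt_congr (θ ξ : ℝ) {x y : ℕ → S × A} {k : ℕ} (h : ∀ i ≤ k + 1, x i = y i) :
    M.noiseAt θ ξ x k = M.noiseAt θ ξ y k := by
  rw [noiseAt, noiseAt, iterate_congr θ ξ fun i hi => h i (by omega), h k (by omega),
    h (k + 1) le_rfl]

lemma err_congr (θ ξ : ℝ) {x y : ℕ → S × A} {k : ℕ} (h : ∀ i ≤ k, x i = y i) :
    M.err θ ξ x k = M.err θ ξ y k := by
  rw [err, err, lower_congr θ ξ h]

lemma IsTrajectory.integrable_cross (hX : M.IsTrajectory μ X) (G : Matrix (S × A) (S × A) ℝ)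
    (θ ξ : ℝ) (k : ℕ) : Integrable (fun ω => M.noiseAt θ ξ (fun i => X i ω) k ⬝ᵥ
      G *ᵥ M.err θ ξ (fun i => X i ω) k) μ :=
  hX.integrable (n := k + 1) (F := fun x => M.noiseAt θ ξ x k ⬝ᵥ G *ᵥ M.err θ ξ x k) fun x y h => by
    rw [noiseAt_congr θ ξ h, err_congr θ ξ fun i hi => h i (by omega)]

variable [Nonempty S] [Nonempty A]

/-- The iterates are frozen at `j = k - τ`. The definition of `K_mix` gives `k ≥ 2τ`, hence `τ ≤ j`,
and that of `τ` gives `m ρ^τ ≤ α_k`. -/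
lemma IsErgodic.integral_cross_le (hM : M.IsErgodic) (h : M.IsAdmissible G c θ ξ)
    (hmix : M.IsMixing m ρ) (hX : M.IsTrajectory μ X) {k : ℕ} (hk : mixStart m ρ θ ξ ≤ k) :
    ∫ ω, M.noiseAt θ ξ (fun i => X i ω) k ⬝ᵥ G *ᵥ M.err θ ξ (fun i => X i ω) k ∂μ ≤
      M.crossBound G * stepSize θ ξ k * (40 * mixTime m ρ (stepSize θ ξ k) + 8) := by
  have hτ := mixTime_spec (m := m) hmix.ρ_pos hmix.ρ_lt_one (h.stepSize_pos k)
  have hτk := mixStart_spec (m := m) hmix.ρ_pos hmix.ρ_lt_one h.θ_pos h.ξ_pos hk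
  generalize mixTime m ρ (stepSize θ ξ k) = τ at hτ hτk ⊢
  obtain ⟨j, rfl⟩ : ∃ j, k = j + τ := ⟨k - τ, by omega⟩
  have hjτ : τ ≤ j := by omega
  have hc : 0 ≤ M.crossBound G := crossBound_nonneg hM.errBound_nonneg
  have h1 := hM.integral_frozen_cross_le (G := G) h hmix hX j τ
  have hint : Integrable (fun ω => M.noise (M.iterate θ ξ (fun i => X i ω) j) (X (j + τ) ω)
      (X (j + τ + 1) ω).1 ⬝ᵥ G *ᵥ M.err θ ξ (fun i => X i ω) j) μ :=
    hX.integrable (n := j + τ + 1) (F := fun x => M.noise (M.iterate θ ξ x j) (x (j + τ))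
      (x (j + τ + 1)).1 ⬝ᵥ G *ᵥ M.err θ ξ x j) fun x y hxy => by
        rw [iterate_congr θ ξ fun i hi => hxy i (by omega), hxy (j + τ) (by omega),
          hxy (j + τ + 1) le_rfl, err_congr θ ξ fun i hi => hxy i (by omega)]
  have h2 := integral_mono (hX.integrable_cross G θ ξ (j + τ))
    (hint.add (integrable_const (40 * M.crossBound G * τ * stepSize θ ξ (j + τ)))) fun ω => by
      have := (le_abs_self _).trans (hM.cross_sub_le h (fun i => X i ω) hjτ)
      rw [Pi.add_apply]
      linarith
  rw [integral_add' hint (integrable_const _), integral_const] at h2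
  simp only [probReal_univ, one_smul] at h2
  have h3 := mul_le_mul_of_nonneg_left hτ (by positivity : 0 ≤ 8 * M.crossBound G)
  linarith

/-- After `K_mix` the cross term is `O(τ α_k)`, and `36 = 2 · 8 + 20`; before it only the pathwise
bound `4 U` is available, with `U = crossBound`. -/
lemma IsErgodic.integral_lyapV_succ_le (hM : M.IsErgodic) (hG : M.IsLyapunov G)
    (h : M.IsAdmissible G c θ ξ) (hmix : M.IsMixing m ρ) (hX : M.IsTrajectory μ X) (k : ℕ) :
    ∫ ω, lyapV (M.z G θ ξ (fun i => X i ω) (k + 1)) ∂μ ≤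
      (1 - 2 / (k + ξ)) * ∫ ω, lyapV (M.z G θ ξ (fun i => X i ω) k) ∂μ
        + (M.crossBound G * stepSize θ ξ k ^ 2 * (80 * mixTime m ρ (stepSize θ ξ k) + 36)
          + if k < mixStart m ρ θ ξ then 8 * M.crossBound G * stepSize θ ξ k else 0) := by
  have hc : 0 ≤ M.crossBound G := crossBound_nonneg hM.errBound_nonneg
  have hα := h.stepSize_pos k
  have hV := hX.integrable_lyapV G θ ξ k
  have hW := hX.integrable_cross G θ ξ k
  have h1 := integral_mono (hX.integrable_lyapV G θ ξ (k + 1))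
    (((hV.const_mul (1 - 2 / (k + ξ))).add (hW.const_mul (2 * stepSize θ ξ k))).add
      (integrable_const (20 * M.crossBound G * stepSize θ ξ k ^ 2)))
    fun ω => hM.drift_step hG h (fun i => X i ω) k
  rw [integral_add' ((hV.const_mul _).add (hW.const_mul _)) (integrable_const _),
    integral_add' (hV.const_mul _) (hW.const_mul _), integral_const, integral_const_mul,
    integral_const_mul] at h1
  simp only [probReal_univ, one_smul] at h1
  have hτ0 : 0 ≤ M.crossBound G * stepSize θ ξ k ^ 2 *
      (80 * (mixTime m ρ (stepSize θ ξ k) : ℝ) + 16) := by positivity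
  split_ifs with hk
  · have h2 : ∫ ω, M.noiseAt θ ξ (fun i => X i ω) k ⬝ᵥ G *ᵥ M.err θ ξ (fun i => X i ω) k ∂μ ≤
        4 * M.crossBound G := by
      refine (integral_mono hW (integrable_const _) fun ω =>
        (le_abs_self _).trans (hM.abs_cross_le h (fun i => X i ω) k)).trans ?_
      simp
    have h3 := mul_le_mul_of_nonneg_left h2 (by positivity : 0 ≤ 2 * stepSize θ ξ k)
    linarith
  · have h2 := hM.integral_cross_le h hmix hX (not_lt.1 hk)
    have h3 := mul_le_mul_of_nonneg_left h2 (by positivity : 0 ≤ 2 * stepSize θ ξ k)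
    linarith

/-- From `η ‖G‖ ≤ 1` and `‖G‖ ≥ 1/2` one gets `η ≤ 2`, so `η θ ≥ 2` forces `1 ≤ θ ≤ ξ`. -/
lemma IsAdmissible.one_le_ξ (h : M.IsAdmissible G c θ ξ) (hG : M.IsLyapunov G)
    (hM : M.IsErgodic) : 1 ≤ ξ := by
  obtain ⟨η, h1, h2⟩ := h.contraction
  have hl := hG.half_le_specNorm hM
  have hα := h.stepSize_pos 0
  have h3 : 0 ≤ stepSize θ ξ 0 * specNorm (M.B G) ^ 2 * specNorm G := by positivity
  have h4 : η * specNorm G ≤ 1 := by linarith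
  refine le_trans ?_ h.θ_le_ξ
  have hθ := h.θ_pos
  have hη : 0 < η := by
    by_contra hcon
    nlinarith
  nlinarith

/-- The mean square bound, in terms of the step-size parameters. -/
lemma IsErgodic.integral_lyapV_le (hM : M.IsErgodic) (hG : M.IsLyapunov G)
    (h : M.IsAdmissible G c θ ξ) (hmix : M.IsMixing m ρ) (hX : M.IsTrajectory μ X) {k : ℕ}
    (hk : mixStart m ρ θ ξ ≤ k) :
    ∫ ω, lyapV (M.z G θ ξ (fun i => X i ω) k) ∂μ ≤
      (ξ * specNorm G * l2norm (M.QL₀ - M.Qstar) ^ 2 + 144 * (θ ^ 2 * M.crossBound G)) / (k + ξ)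
        + (320 * (θ ^ 2 * M.crossBound G) + 64 * (θ * M.crossBound G))
          * (mixTime m ρ (stepSize θ ξ k) / (k + ξ)) := by
  have hc : 0 ≤ M.crossBound G := crossBound_nonneg hM.errBound_nonneg
  have hξ1 := h.one_le_ξ hG hM
  have hξ := h.ξ_pos
  have hθ := h.θ_pos
  have hV : ∀ v : S × A → ℝ, 0 ≤ lyapV v := fun v => by
    rw [lyapV, ← l2norm_sq]; positivity
  have hb : ∀ i : ℕ, 0 ≤ M.crossBound G * stepSize θ ξ i ^ 2 *
      (80 * (mixTime m ρ (stepSize θ ξ i) : ℝ) + 36) +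
        if i < mixStart m ρ θ ξ then 8 * M.crossBound G * stepSize θ ξ i else 0 := fun i => by
    have := (h.stepSize_pos i).le
    refine add_nonneg (by positivity) ?_
    split_ifs <;> positivity
  have hrec := weighted_sum_of_recursion
    (a := fun i => ∫ ω, lyapV (M.z G θ ξ (fun l => X l ω) i) ∂μ) hξ1 (fun i => integral_nonneg fun ω => hV _) hb
    (fun i => hM.integral_lyapV_succ_le hG h hmix hX i) k
  have h0 : ∫ ω, lyapV (M.z G θ ξ (fun i => X i ω) 0) ∂μ ≤
      specNorm G * l2norm (M.QL₀ - M.Qstar) ^ 2 := by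
    have e : ∀ ω, lyapV (M.z G θ ξ (fun i => X i ω) 0) =
        (M.QL₀ - M.Qstar) ⬝ᵥ G *ᵥ (M.QL₀ - M.Qstar) := fun ω => hG.lyapV_z _ _ _ 0
    simp only [e, integral_const, probReal_univ, one_smul]
    refine (le_abs_self _).trans ((abs_dotProduct_mulVec_le G _ _).trans (le_of_eq ?_))
    ring
  set K := mixStart m ρ θ ξ with hK
  set τ := mixTime m ρ (stepSize θ ξ k) with hτ
  set U := M.crossBound G
  set x := (k : ℝ) + ξ with hx
  have hk0 : (0 : ℝ) ≤ k := Nat.cast_nonneg k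
  have hxpos : 0 < x := by linarith
  -- Since `(i+ξ) α_i = θ`, the weight exactly cancels `α_i²`; the early terms keep one factor `i +
  -- ξ ≤ x`.
  have hterm : ∀ i ∈ Finset.range k, 4 * ((i : ℝ) + ξ) ^ 2 * (U * stepSize θ ξ i ^ 2 *
      (80 * (mixTime m ρ (stepSize θ ξ i) : ℝ) + 36) +
        if i < K then 8 * U * stepSize θ ξ i else 0) ≤
      4 * (θ ^ 2 * U * (80 * τ + 36)) + if i < K then 32 * (θ * U) * x else 0 := by
    intro i hi
    have hik : i ≤ k := (Finset.mem_range.1 hi).le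
    have hik' : (i : ℝ) ≤ k := by exact_mod_cast hik
    have hy : 0 < (i : ℝ) + ξ := by positivity
    have hα : ((i : ℝ) + ξ) * stepSize θ ξ i = θ := by
      rw [stepSize]; field_simp
    have hτi : (mixTime m ρ (stepSize θ ξ i) : ℝ) ≤ τ := by
      exact_mod_cast mixTime_anti hmix.ρ_pos hmix.ρ_lt_one (h.stepSize_pos k)
        (stepSize_anti hθ.le hξ hik)
    rw [mul_add]
    refine add_le_add ?_ ?_
    · calc 4 * ((i : ℝ) + ξ) ^ 2 * (U * stepSize θ ξ i ^ 2 *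
            (80 * (mixTime m ρ (stepSize θ ξ i) : ℝ) + 36))
          = 4 * ((((i : ℝ) + ξ) * stepSize θ ξ i) ^ 2 * U *
            (80 * (mixTime m ρ (stepSize θ ξ i) : ℝ) + 36)) := by ring
        _ ≤ 4 * (θ ^ 2 * U * (80 * τ + 36)) := by rw [hα]; gcongr
    · split_ifs
      · calc 4 * ((i : ℝ) + ξ) ^ 2 * (8 * U * stepSize θ ξ i)
            = 32 * ((((i : ℝ) + ξ) * stepSize θ ξ i) * U) * ((i : ℝ) + ξ) := by ring
          _ ≤ 32 * (θ * U) * x := by rw [hα, hx]; gcongr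
      · simp
  have hKτ : (K : ℝ) ≤ 2 * τ := by
    exact_mod_cast mixStart_le (m := m) hmix.ρ_pos hmix.ρ_lt_one hθ hξ hk
  -- At most `K ≤ 2τ` terms are early, so both parts carry the factor `x` that is divided out at the
  -- end.
  have hsum : ∑ i ∈ Finset.range k, (4 * (θ ^ 2 * U * (80 * τ + 36)) +
      if i < K then 32 * (θ * U) * x else 0) ≤
        x * (4 * (θ ^ 2 * U * (80 * τ + 36))) + 2 * τ * (32 * (θ * U) * x) := by
    rw [Finset.sum_add_distrib, Finset.sum_const, Finset.card_range, nsmul_eq_mul,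
      ← Finset.sum_filter, Finset.sum_const, nsmul_eq_mul]
    have hcard : ((Finset.range k |>.filter (· < K)).card : ℝ) ≤ K := by
      have : (Finset.range k |>.filter (· < K)) ⊆ Finset.range K := fun i hi =>
        Finset.mem_range.2 (Finset.mem_filter.1 hi).2
      exact_mod_cast (Finset.card_le_card this).trans (Finset.card_range K).le
    have hkx : (k : ℝ) ≤ x := by linarith
    gcongr
    exact hcard.trans hKτ
  have htot := hrec.trans (add_le_add_right ((Finset.sum_le_sum hterm).trans hsum) _)
  have hξx : ξ ^ 2 * ∫ ω, lyapV (M.z G θ ξ (fun i => X i ω) 0) ∂μ ≤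
      x * (ξ * specNorm G * l2norm (M.QL₀ - M.Qstar) ^ 2) := by
    have hs := specNorm_nonneg G
    calc _ ≤ ξ ^ 2 * (specNorm G * l2norm (M.QL₀ - M.Qstar) ^ 2) := by gcongr
      _ = ξ * (ξ * specNorm G * l2norm (M.QL₀ - M.Qstar) ^ 2) := by ring
      _ ≤ _ := by
        have : ξ ≤ x := by linarith
        gcongr
  have hfin : x ^ 2 * ∫ ω, lyapV (M.z G θ ξ (fun i => X i ω) k) ∂μ ≤
      x * (ξ * specNorm G * l2norm (M.QL₀ - M.Qstar) ^ 2 + 144 * (θ ^ 2 * U)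
        + (320 * (θ ^ 2 * U) + 64 * (θ * U)) * τ) := by
    linarith
  rw [mul_div_assoc', ← add_div, le_div_iff₀ hxpos]
  rw [sq, mul_assoc] at hfin
  have := le_of_mul_le_mul_left hfin hxpos
  linarith

end MeanSquare

end QModel

/-! ### Explicit constants -/

namespace QModel

section Constants

variable {S A : Type*} [Fintype S] [Fintype A] [DecidableEq S] [DecidableEq A] {M : QModel S A}
  {G : Matrix (S × A) (S × A) ℝ} {c θ ξ : ℝ} [Nonempty S] [Nonempty A]

lemma IsLyapunov.crossBound_le (hG : M.IsLyapunov G) (hM : M.IsErgodic) :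
    M.crossBound G ≤ 8 * (M.size * √M.size / ((1 - M.γ) ^ 4 * M.dmin ^ 2)) := by
  have hp : 0 < 1 - M.γ := sub_pos.2 M.γ_lt_one
  have hd := hM.dmin_pos
  have hn : 1 ≤ M.size := one_le_size
  have hl := hG.specNorm_le hM
  rw [crossBound, errBound, horizon]
  calc 1 / (1 - M.γ) * specNorm G *
        (√M.size * (4 * (1 / (1 - M.γ)) / ((1 - M.γ) * M.dmin)))
      ≤ 1 / (1 - M.γ) * (2 * M.size / ((1 - M.γ) * M.dmin)) *
        (√M.size * (4 * (1 / (1 - M.γ)) / ((1 - M.γ) * M.dmin))) := by gcongr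
    _ = _ := by field_simp; ring

lemma IsAdmissible.sq_mul_crossBound_le (h : M.IsAdmissible G c θ ξ) (hG : M.IsLyapunov G)
    (hM : M.IsErgodic) : θ ^ 2 * M.crossBound G ≤
      8 * c ^ 2 * (M.size ^ 3 * √M.size / ((1 - M.γ) ^ 6 * M.dmin ^ 4)) := by
  have hp : 0 < 1 - M.γ := sub_pos.2 M.γ_lt_one
  have hd := hM.dmin_pos
  have hc : 0 ≤ M.crossBound G := crossBound_nonneg hM.errBound_nonneg
  have hU := hG.crossBound_le hM
  calc θ ^ 2 * M.crossBound G ≤ (c * (M.size / ((1 - M.γ) * M.dmin))) ^ 2 *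
        (8 * (M.size * √M.size / ((1 - M.γ) ^ 4 * M.dmin ^ 2))) := by
        gcongr
        · exact h.θ_pos.le
        · exact h.θ_le
    _ = _ := by field_simp

/-- A spare factor `n/δ ≥ 1` brings the bound to the form of the one for `θ² U`. -/
lemma IsAdmissible.mul_crossBound_le (h : M.IsAdmissible G c θ ξ) (hc0 : 0 < c)
    (hG : M.IsLyapunov G) (hM : M.IsErgodic) : θ * M.crossBound G ≤
      8 * c * (M.size ^ 3 * √M.size / ((1 - M.γ) ^ 6 * M.dmin ^ 4)) := by
  have hp : 0 < 1 - M.γ := sub_pos.2 M.γ_lt_one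
  have hd := hM.dmin_pos
  have hn : 1 ≤ M.size := one_le_size
  have hc : 0 ≤ M.crossBound G := crossBound_nonneg hM.errBound_nonneg
  have hU := hG.crossBound_le hM
  have hone : 1 ≤ M.size / ((1 - M.γ) * M.dmin) := by
    rw [le_div_iff₀ hM.rate_pos]
    linarith [hM.rate_le_one]
  calc θ * M.crossBound G ≤ (c * (M.size / ((1 - M.γ) * M.dmin))) *
        (8 * (M.size * √M.size / ((1 - M.γ) ^ 4 * M.dmin ^ 2))) := by
        gcongr
        exact h.θ_le
    _ ≤ (c * (M.size / ((1 - M.γ) * M.dmin))) *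
        (8 * (M.size * √M.size / ((1 - M.γ) ^ 4 * M.dmin ^ 2))) *
          (M.size / ((1 - M.γ) * M.dmin)) := le_mul_of_one_le_right (by positivity) hone
    _ = _ := by field_simp

lemma IsAdmissible.ξ_mul_specNorm_le (h : M.IsAdmissible G c θ ξ) (hc0 : 0 < c)
    (hG : M.IsLyapunov G) (hM : M.IsErgodic) : ξ * specNorm G ≤
      2 * c * (M.size ^ (11 / 2 : ℝ) * M.dmax ^ 2 / ((1 - M.γ) ^ 3 * M.dmin ^ 3)) := by
  have hp : 0 < 1 - M.γ := sub_pos.2 M.γ_lt_one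
  have hd := hM.dmin_pos
  have hn : 1 ≤ M.size := one_le_size
  have hpow : M.size ^ (11 / 2 : ℝ) = M.size ^ (9 / 2 : ℝ) * M.size := by
    rw [← Real.rpow_add_one (by linarith)]; norm_num
  have hs := specNorm_nonneg G
  rw [hpow]
  calc ξ * specNorm G
      ≤ (c * (M.size ^ (9 / 2 : ℝ) * M.dmax ^ 2 / ((1 - M.γ) ^ 2 * M.dmin ^ 2))) *
        (2 * M.size / ((1 - M.γ) * M.dmin)) :=
        mul_le_mul h.ξ_le (hG.specNorm_le hM) hs (by positivity)
    _ = _ := by field_simp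

-- The estimates produce the exponent `7/2`, below both `5` and `21/4`.
omit [DecidableEq S] [DecidableEq A] in
lemma size_pow_mul_sqrt_le : M.size ^ 3 * √M.size ≤ M.size ^ 5 ∧
    M.size ^ 3 * √M.size ≤ M.size ^ (21 / 4 : ℝ) := by
  have hn : 1 ≤ M.size := one_le_size
  have e : M.size ^ 3 * √M.size = M.size ^ (7 / 2 : ℝ) := by
    rw [Real.sqrt_eq_rpow, ← Real.rpow_natCast, ← Real.rpow_add (by linarith)]; norm_num
  rw [e, ← Real.rpow_natCast]
  constructor <;> exact Real.rpow_le_rpow_of_exponent_le hn (by norm_num)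

end Constants

end QModel

theorem mainTheorem4 :
    (∃ c₀ : ℝ, 0 < c₀ ∧
      ∀ (S : Type u) (A : Type v) [Fintype S] [Fintype A] [DecidableEq S] [DecidableEq A]
        [Nonempty S] [Nonempty A] (M : QModel S A), M.IsErgodic →
        (∃ m ρ : ℝ, M.IsMixing m ρ) ∧
        (∃! G : Matrix (S × A) (S × A) ℝ, M.IsLyapunov G) ∧
        ∀ G : Matrix (S × A) (S × A) ℝ, M.IsLyapunov G →
          M.IsAdmissible G c₀ (4 * specNorm G)
            (max (4 * specNorm G) (8 * specNorm G ^ 2 * specNorm (M.B G) ^ 2))) ∧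
    (∀ c : ℝ, 0 < c → ∃ C : ℝ, 0 < C ∧
      ∀ (S : Type u) (A : Type v) [Fintype S] [Fintype A] [DecidableEq S] [DecidableEq A]
        [Nonempty S] [Nonempty A] (M : QModel S A), M.IsErgodic →
        ∀ G : Matrix (S × A) (S × A) ℝ, M.IsLyapunov G →
        ∀ m ρ : ℝ, M.IsMixing m ρ →
        ∀ θ ξ : ℝ, M.IsAdmissible G c θ ξ →
        ∀ (Ω : Type w) [MeasurableSpace Ω] (μ : Measure Ω) [IsProbabilityMeasure μ]
          (X : ℕ → Ω → S × A), M.IsTrajectory μ X →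
        ∀ k : ℕ, mixStart m ρ θ ξ ≤ k →
          Integrable (fun ω => lyapV (M.z G θ ξ (fun i => X i ω) k)) μ ∧
          ∫ ω, lyapV (M.z G θ ξ (fun i => X i ω) k) ∂μ ≤
            M.C₂ C / (k + ξ)
            + C * M.size ^ (21 / 4 : ℝ) / ((1 - M.γ) ^ 6 * M.dmin ^ 4)
              * (mixTime m ρ (stepSize θ ξ k) / (k + ξ))) := by
  -- `2560 = 320 · 8` and `512 = 64 · 8` come from the mixing-time term; the other term needs only
  -- `1152 c² + 2 c`.
  refine ⟨⟨128, by norm_num, fun S A _ _ _ _ _ _ M hM => ⟨hM.exists_isMixing,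
    hM.existsUnique_isLyapunov, fun G hG => hG.isAdmissible hM⟩⟩, fun c hc =>
    ⟨2560 * c ^ 2 + 512 * c, by positivity, ?_⟩⟩
  intro S A _ _ _ _ _ _ M hM G hG m ρ hmix θ ξ h Ω _ μ _ X hX k hk
  refine ⟨hX.integrable_lyapV G θ ξ k, (hM.integral_lyapV_le hG h hmix hX hk).trans ?_⟩
  have hp : 0 < 1 - M.γ := sub_pos.2 M.γ_lt_one
  have hd := hM.dmin_pos
  have hξ := h.ξ_pos
  have h1 := h.sq_mul_crossBound_le hG hM
  have h2 := h.mul_crossBound_le hc hG hM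
  have h3 := h.ξ_mul_specNorm_le hc hG hM
  obtain ⟨h4, h5⟩ := QModel.size_pow_mul_sqrt_le (M := M)
  have h6 : M.size ^ 3 * √M.size / ((1 - M.γ) ^ 6 * M.dmin ^ 4) ≤
      M.size ^ 5 / ((1 - M.γ) ^ 6 * M.dmin ^ 4) := by gcongr
  have h7 : M.size ^ 3 * √M.size / ((1 - M.γ) ^ 6 * M.dmin ^ 4) ≤
      M.size ^ (21 / 4 : ℝ) / ((1 - M.γ) ^ 6 * M.dmin ^ 4) := by gcongr
  have h8 : 0 ≤ M.size ^ 3 * √M.size / ((1 - M.γ) ^ 6 * M.dmin ^ 4) := by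
    have : 1 ≤ M.size := QModel.one_le_size
    positivity
  rw [QModel.C₂]
  change _ ≤ (2560 * c ^ 2 + 512 * c) * max (_ * l2norm (M.QL₀ - M.Qstar) ^ 2) _ / _ + _
  refine add_le_add ?_ ?_
  · refine div_le_div_of_nonneg_right ?_ (by positivity)
    have h9 := mul_le_mul_of_nonneg_right h3 (sq_nonneg (l2norm (M.QL₀ - M.Qstar)))
    set x₁ := M.size ^ (11 / 2 : ℝ) * M.dmax ^ 2 / ((1 - M.γ) ^ 3 * M.dmin ^ 3)
      * l2norm (M.QL₀ - M.Qstar) ^ 2 with hx₁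
    set x₂ := M.size ^ 5 / ((1 - M.γ) ^ 6 * M.dmin ^ 4)
    have h10 : x₁ ≤ max x₁ x₂ := le_max_left _ _
    have h11 : x₂ ≤ max x₁ x₂ := le_max_right _ _
    have h12 : 0 ≤ max x₁ x₂ := (h8.trans h6).trans h11
    rw [mul_assoc (2 * c), ← hx₁] at h9
    calc ξ * specNorm G * l2norm (M.QL₀ - M.Qstar) ^ 2 + 144 * (θ ^ 2 * M.crossBound G)
        ≤ 2 * c * max x₁ x₂ + 144 * (8 * c ^ 2 * max x₁ x₂) := by
          refine add_le_add (h9.trans (by gcongr)) ?_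
          refine mul_le_mul_of_nonneg_left (h1.trans ?_) (by norm_num)
          exact mul_le_mul_of_nonneg_left (h6.trans h11) (by positivity)
      _ = (1152 * c ^ 2 + 2 * c) * max x₁ x₂ := by ring
      _ ≤ (2560 * c ^ 2 + 512 * c) * max x₁ x₂ := by gcongr <;> norm_num
  · refine mul_le_mul_of_nonneg_right ?_ (by positivity)
    calc 320 * (θ ^ 2 * M.crossBound G) + 64 * (θ * M.crossBound G)
        ≤ 320 * (8 * c ^ 2 * (M.size ^ (21 / 4 : ℝ) / ((1 - M.γ) ^ 6 * M.dmin ^ 4)))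
          + 64 * (8 * c * (M.size ^ (21 / 4 : ℝ) / ((1 - M.γ) ^ 6 * M.dmin ^ 4))) := by
          refine add_le_add (mul_le_mul_of_nonneg_left (h1.trans ?_) (by norm_num))
            (mul_le_mul_of_nonneg_left (h2.trans ?_) (by norm_num)) <;>
          exact mul_le_mul_of_nonneg_left h7 (by positivity)
      _ = _ := by ring
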